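/- Let $N\ge 2$ be an integer, $\mathbb{T}=\mathbb{R}/2\pi\mathbb{Z}$ with normalized Haar measure (identify $t$ with $z=e^{-it}$), and let $m_0:\mathbb{T}\to\mathbb{C}$ be uniformly Lipschitz, i.e. $|m_0(t)-m_0(s)|\le K|t-s|$ for all $t,s\in\mathbb{R}$ and some $K>0$, with $m_0(0)=\sqrt N$. Let $\varphi\in L^2(\mathbb{R})$ and let $\hat\varphi$ be a representative of its Fourier transform $\hat\varphi(t)=(2\pi)^{-1/2}\int e^{-ixt}\varphi(x)\,dx$. Assume that $\sqrt N\,\hat\varphi(Nt)=m_0(t)\hat\varphi(t)$ for almost all $t\in\mathbb{R}$, that $\hat\varphi$ is continuous at $0$, and that $\hat\varphi(0)=(2\pi)^{-1/2}$. Then the product $\Phi(t):=(2\pi)^{-1/2}\prod_{k=1}^{\infty}\bigl(N^{-1/2}m_0(tN^{-k})\bigr)$ converges for every $t\in\mathbb{R}$, and $\hat\varphi=\Phi$ almost everywhere. Write $\mathrm{PER}(g)(t)=\sum_{k\in\mathbb{Z}}g(t+2\pi k)$, let $R:C(\mathbb{T})\to C(\mathbb{T})$ be the transfer operator $(R\xi)(z)=\frac1N\sum_{w^N=z}|m_0(w)|^2\xi(w)$,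 let $S_0$ be the bounded operator $(S_0f)(z)=m_0(z)f(z^N)$ on $L^2(\mathbb{T})$, and let $M_f$ be multiplication by $f$ on $L^2(\mathbb{T})$. The following are equivalent: 1. $\{\varphi(\cdot-k)\}_{k\in\mathbb{Z}}$ is an orthonormal set in $L^2(\mathbb{R})$; 2. $\mathrm{PER}(|\hat\varphi|^2)(t)=(2\pi)^{-1}$ for almost all $t$; 3. $\mathrm{PER}(|\Phi|^2)(t)=(2\pi)^{-1}$ for every $t\in\mathbb{R}$; 4. up to a scalar, the constant function $1$ is the unique eigenvector of $R$ of eigenvalue $1$, i.e. $\{\xi\in C(\mathbb{T}):R\xi=\xi\}=\mathbb{C}\,1$; 5. $\sum_{w^N=z}|m_0(w)|^2=N$ for almost all $z\in\mathbb{T}$, and $\lim_{n\to\infty}\langle 1,S_0^{*n}M_fS_0^n1\rangle_{L^2(\mathbb{T})}=f(0)$ for all $f\in C(\mathbb{T})$. Moreover, if $\sum_{w^N=z}|m_0(w)|^2=N$ for almost all $z\in\mathbb{T}$, then $S_0$ is an isometry, and $\{\varphi(\cdot-k)\}_{k\in\mathbb{Z}}$ is orthonormal if and only if $\lim_{n\to\infty}\langle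 1,S_0^{*n}M_fS_0^n1\rangle=f(0)$ for all $f\in C(\mathbb{T})$. -/

import Mathlib

open MeasureTheory Filter Topology
open scoped Real ENNReal FourierTransform

noncomputable section

namespace ScalingFunction

instance fact_two_pi_pos : Fact (0 < 2 * π) := ⟨Real.two_pi_pos⟩

/-- The circle `𝕋 = ℝ / 2πℤ`, written additively: the point `z = e^{-it}` is the class of `t`,
the map `z ↦ z ^ N` is `w ↦ N • w`, and the point `z = 1` is `0`. -/
abbrev Torus : Type := AddCircle (2 * π)

/-- `L²(𝕋)` with respect to normalized Haar measure `|dz| / 2π`. -/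
abbrev L2Torus : Type := Lp ℂ 2 (AddCircle.haarAddCircle : Measure Torus)

/-- `L²(ℝ)` with respect to Lebesgue measure. -/
abbrev L2Real : Type := Lp ℂ 2 (volume : Measure ℝ)

/-! ### The line -/

/-- The translate `φ(· - k)`. -/
def translate (φ : L2Real) (k : ℤ) : L2Real :=
  Lp.compMeasurePreserving (fun x : ℝ => x - (k : ℝ))
    (measurePreserving_sub_right volume (k : ℝ)) φ

/-- The unitary Fourier transform `φ̂(t) = (2π)^{-1/2} ∫ e^{-ixt} φ(x) dx` of an `L²` function
(a function determined up to null sets), in terms of Mathlib's Plancherel transform, whose kernel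
is `e^{-2πixξ}`. -/
def fourierHat (φ : L2Real) (t : ℝ) : ℂ :=
  (((2 * π) ^ (-(1 / 2) : ℝ) : ℝ) : ℂ) * (𝓕 φ : L2Real) (t / (2 * π))

/-- `PER(g)(t) = ∑_{k ∈ ℤ} g(t + 2πk)`. -/
def PER (g : ℝ → ℝ) (t : ℝ) : ℝ :=
  ∑' k : ℤ, g (t + 2 * π * k)

/-- The `k`-th factor `N^{-1/2} m₀(t N^{-k})` of the infinite product. -/
def productFactor (N : ℕ) (m₀ : C(Torus, ℂ)) (t : ℝ) (k : ℕ) : ℂ :=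
  (((N : ℝ) ^ (-(1 / 2) : ℝ) : ℝ) : ℂ) * m₀ ((t / (N : ℝ) ^ k : ℝ) : Torus)

/-- `(2π)^{-1/2} ∏_{k ≥ 1} (N^{-1/2} m₀(t N^{-k}))`. -/
def scalingProduct (N : ℕ) (m₀ : C(Torus, ℂ)) (t : ℝ) : ℂ :=
  (((2 * π) ^ (-(1 / 2) : ℝ) : ℝ) : ℂ) * ∏' k : ℕ, productFactor N m₀ t (k + 1)

/-! ### The circle -/

/-- `∑_{w ^ N = z} F(w)`. -/
def preimageSum (N : ℕ) (F : Torus → ℂ) (z : Torus) : ℂ :=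
  ∑ᶠ w ∈ {w : Torus | N • w = z}, F w

theorem coe_eq_coe_iff (x y : ℝ) : (x : Torus) = (y : Torus) ↔ ∃ m : ℤ, x - y = 2 * π * m := by
  rw [← sub_eq_zero, ← AddCircle.coe_sub, AddCircle.coe_eq_zero_iff]
  constructor
  · rintro ⟨m, hm⟩
    exact ⟨m, by rw [← hm, zsmul_eq_mul]; ring⟩
  · rintro ⟨m, hm⟩
    exact ⟨m, by rw [hm, zsmul_eq_mul]; ring⟩

/-- The sum over preimages, in the real coordinate: the `N`-th roots of the class of `t` are the
classes of `(t + 2πk) / N`, `0 ≤ k < N`. -/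
theorem preimageSum_coe {N : ℕ} (hN : 2 ≤ N) (F : Torus → ℂ) (t : ℝ) :
    preimageSum N F (t : Torus) =
      ∑ k ∈ Finset.range N, F (((t + 2 * π * k) / N : ℝ) : Torus) := by
  classical
  have hN0 : (N : ℝ) ≠ 0 := by positivity
  have hpi : (2 * π : ℝ) ≠ 0 := Real.two_pi_pos.ne'
  have hinj : Set.InjOn (fun k : ℕ => (((t + 2 * π * k) / N : ℝ) : Torus))
      (Finset.range N : Set ℕ) := by
    intro k hk l hl h
    simp only [Finset.coe_range, Set.mem_Iio] at hk hl
    obtain ⟨m, hm⟩ := (coe_eq_coe_iff _ _).1 h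
    have h1 : 2 * π * ((k : ℝ) - l) = 2 * π * (N * m) := by
      field_simp at hm
      linarith
    have h2 : ((k : ℤ) - l) = N * m := by exact_mod_cast mul_left_cancel₀ hpi h1
    have h3 : (k : ℤ) ≡ l [ZMOD N] :=
      (Int.modEq_iff_dvd.2 ⟨m, h2⟩).symm
    have h4 : k ≡ l [MOD N] := (Int.natCast_modEq_iff).1 h3
    exact Nat.ModEq.eq_of_lt_of_lt h4 hk hl
  have hset : {w : Torus | N • w = (t : Torus)} =
      ((Finset.range N).image (fun k : ℕ => (((t + 2 * π * k) / N : ℝ) : Torus)) : Set Torus) := by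
    ext w
    induction w using QuotientAddGroup.induction_on with
    | H s =>
      simp only [Set.mem_ofPred_eq, Finset.coe_image, Finset.coe_range, Set.mem_image, Set.mem_Iio]
      change N • ((s : ℝ) : Torus) = _ ↔ ∃ k : ℕ, _ ∧ _ = ((s : ℝ) : Torus)
      rw [← AddCircle.coe_nsmul, coe_eq_coe_iff]
      constructor
      · rintro ⟨m, hm⟩
        have hNz : (0 : ℤ) < N := by omega
        refine ⟨(m % N).toNat, ?_, ?_⟩
        · have := Int.emod_lt_of_pos m hNz
          omega
        · rw [coe_eq_coe_iff]
          refine ⟨-(m / N), ?_⟩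
          have h1 : (((m % N).toNat : ℕ) : ℝ) = (m : ℝ) - N * ((m / N : ℤ) : ℝ) := by
            have h2 : (((m % N).toNat : ℕ) : ℤ) = m - N * (m / N) := by
              rw [Int.toNat_of_nonneg (Int.emod_nonneg _ hNz.ne'), Int.emod_def]
            exact_mod_cast h2
          rw [h1]
          rw [nsmul_eq_mul] at hm
          push_cast
          field_simp
          linarith
      · rintro ⟨k, -, hk⟩
        obtain ⟨m, hm⟩ := (coe_eq_coe_iff _ _).1 hk
        refine ⟨k - N * m, ?_⟩
        rw [nsmul_eq_mul]
        push_cast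
        field_simp at hm
        linarith
  rw [preimageSum, hset, finsum_mem_coe_finset, Finset.sum_image hinj]

theorem continuous_preimageSum {N : ℕ} (hN : 2 ≤ N) {F : Torus → ℂ} (hF : Continuous F) :
    Continuous (preimageSum N F) := by
  have hq : IsQuotientMap ((↑) : ℝ → Torus) := QuotientAddGroup.isQuotientMap_mk _
  rw [hq.continuous_iff]
  have h : preimageSum N F ∘ ((↑) : ℝ → Torus) =
      fun t : ℝ => ∑ k ∈ Finset.range N, F (((t + 2 * π * k) / N : ℝ) : Torus) :=
    funext fun t => preimageSum_coe hN F t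
  rw [h]
  refine continuous_finsetSum _ fun k _ => hF.comp ?_
  exact (AddCircle.continuous_mk' (2 * π)).comp (by fun_prop)

/-- The transfer operator `R : C(𝕋) → C(𝕋)`,
`(R ξ)(z) = (1/N) ∑_{w ^ N = z} |m₀(w)|² ξ(w)`. -/
def transferOperator {N : ℕ} (hN : 2 ≤ N) (m₀ : C(Torus, ℂ)) : Module.End ℂ C(Torus, ℂ) where
  toFun ξ :=
    { toFun := fun z => (1 / (N : ℂ)) * preimageSum N (fun w => ((‖m₀ w‖ ^ 2 : ℝ) : ℂ) * ξ w) z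
      continuous_toFun := continuous_const.mul (continuous_preimageSum hN (by fun_prop)) }
  map_add' ξ η := by
    ext z
    induction z using QuotientAddGroup.induction_on with
    | H t =>
      change _ * preimageSum N _ ((t : ℝ) : Torus) =
        _ * preimageSum N _ ((t : ℝ) : Torus) + _ * preimageSum N _ ((t : ℝ) : Torus)
      rw [preimageSum_coe hN, preimageSum_coe hN, preimageSum_coe hN, ← mul_add,
        ← Finset.sum_add_distrib]
      simp only [ContinuousMap.add_apply, mul_add]
  map_smul' c ξ := by
    ext z
    induction z using QuotientAddGroup.induction_on with
    | H t =>
      change _ * preimageSum N _ ((t : ℝ) : Torus) =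
        c * (_ * preimageSum N _ ((t : ℝ) : Torus))
      rw [preimageSum_coe hN, preimageSum_coe hN, mul_left_comm c]
      congr 1
      rw [Finset.mul_sum]
      refine Finset.sum_congr rfl fun k _ => ?_
      simp only [ContinuousMap.smul_apply, smul_eq_mul, mul_left_comm c]

/-- `∑_{w ^ N = z} |m₀(w)|² = N` for almost all `z`. -/
def QuadratureCondition (N : ℕ) (m₀ : C(Torus, ℂ)) : Prop :=
  ∀ᵐ z ∂(AddCircle.haarAddCircle : Measure Torus),
    preimageSum N (fun w => ((‖m₀ w‖ ^ 2 : ℝ) : ℂ)) z = N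

/-- The multiplication operator `M_f` on `L²(𝕋)`. -/
def mulOp (f : C(Torus, ℂ)) : L2Torus →L[ℂ] L2Torus :=
  (ContinuousLinearMap.mul ℂ ℂ).holderL (AddCircle.haarAddCircle : Measure Torus) ∞ 2 2
    (ContinuousMap.toLp ∞ AddCircle.haarAddCircle ℂ f)

theorem mulOp_ae (f : C(Torus, ℂ)) (g : L2Torus) :
    mulOp f g =ᵐ[AddCircle.haarAddCircle] fun z => f z * g z := by
  have h := (ContinuousLinearMap.mul ℂ ℂ).coeFn_holder (r := 2)
    (ContinuousMap.toLp (E := ℂ) ∞ (AddCircle.haarAddCircle : Measure Torus) ℂ f) g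
  refine h.trans ?_
  filter_upwards [ContinuousMap.coeFn_toLp (p := ∞) (𝕜 := ℂ)
    (AddCircle.haarAddCircle : Measure Torus) f] with z hz
  rw [hz]
  rfl

theorem measurePreserving_power {N : ℕ} (hN : 2 ≤ N) :
    MeasurePreserving (fun z : Torus => N • z) AddCircle.haarAddCircle AddCircle.haarAddCircle := by
  have h := MeasureTheory.Measure.measurePreserving_zsmul (AddCircle.haarAddCircle : Measure Torus)
    (n := (N : ℤ)) (by omega)
  simpa only [natCast_zsmul] using h

/-- The operator `(S₀ f)(z) = m₀(z) f(z ^ N)` on `L²(𝕋)`. -/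
def S₀ {N : ℕ} (hN : 2 ≤ N) (m₀ : C(Torus, ℂ)) : L2Torus →L[ℂ] L2Torus :=
  mulOp m₀ ∘L
    (Lp.compMeasurePreservingₗᵢ ℂ (fun z : Torus => N • z)
      (measurePreserving_power hN)).toContinuousLinearMap

theorem S₀_ae {N : ℕ} (hN : 2 ≤ N) (m₀ : C(Torus, ℂ)) (g : L2Torus) :
    S₀ hN m₀ g =ᵐ[AddCircle.haarAddCircle] fun z => m₀ z * g (N • z) := by
  refine (mulOp_ae m₀ _).trans ?_
  filter_upwards [Lp.coeFn_compMeasurePreserving g (measurePreserving_power hN)] with z hz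
  exact congrArg (m₀ z * ·) hz

/-- The constant function `1` in `L²(𝕋)`. -/
def oneL2 : L2Torus := ContinuousMap.toLp 2 AddCircle.haarAddCircle ℂ (1 : C(Torus, ℂ))

/-- `⟨1, S₀*ⁿ M_f S₀ⁿ 1⟩ → f(0)` as `n → ∞`, for every `f ∈ C(𝕋)`. -/
def DiracLimit {N : ℕ} (hN : 2 ≤ N) (m₀ : C(Torus, ℂ)) : Prop :=
  ∀ f : C(Torus, ℂ),
    Tendsto (fun n : ℕ => inner ℂ oneL2
      ((ContinuousLinearMap.adjoint (S₀ hN m₀) ^ n * mulOp f * S₀ hN m₀ ^ n) oneL2))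
      atTop (𝓝 (f 0))

end ScalingFunction

end

/-! Iterating the scaling relation and using continuity of `φhat` at 0 identifies it almost
everywhere with Φ. By Plancherel, the inner products of the translates are the Fourier coefficients
of the measure obtained by wrapping |φ̂|² dt around the circle. Orthonormality says that this
measure is normalized Haar measure, that is, PER(|φ̂|²) = 1/(2π) almost everywhere
(`orthonormal_iff_per`).

The other conditions concern the dynamics of R. Periodization intertwines R with the operator χ ↦
N⁻¹|m₀(t/N)|² χ(t/N) on the line, which fixes |Φ|². Hence p = 2π PER(|Φ|²) is R-invariant once the
series converges. Under the quadrature condition R is an averaging operator, and for a bump u at 0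
the powers Rⁿ(uf) converge pointwise to f(0)p (`Quadrature.tendsto_pow_bump_mul`): on the line they
are partial products of |Φ|² times a dilated bump, dominated by a multiple of |Φ|². It follows that
p ≤ 1 and p(0) = 1, and p is continuous because R keeps Lipschitz constants bounded
(`Quadrature.continuous_periodizedSq`).

If p = 1, then Rⁿ(1 - u) → 0, so Rⁿf → f(0) for every f (`Quadrature.tendsto_pow`). Fixed functions
are then constant, and integrating gives the Dirac limit, since ⟨1, S₀*ⁿ M_f S₀ⁿ 1⟩ = ∫ Rⁿf
(`inner_adjoint_pow`). Conversely, a one-dimensional eigenspace makes p constant, equal to p(0) = 1;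
the Dirac limit tested on u gives ∫ p = 1, which with p ≤ 1 and continuity again forces p = 1. -/

noncomputable section

namespace ScalingFunction

variable {N : ℕ} {m₀ : C(Torus, ℂ)}

/-! ### The infinite product -/

/-- Uniform Lipschitz continuity of `m₀` in the real coordinate. -/
def LipschitzBound (m₀ : C(Torus, ℂ)) (K : ℝ) : Prop :=
  0 < K ∧ ∀ t s : ℝ, ‖m₀ (t : Torus) - m₀ (s : Torus)‖ ≤ K * |t - s|

theorem rpow_neg_half (x : ℝ) (hx : 0 ≤ x) : x ^ (-(1 / 2) : ℝ) = (√x)⁻¹ := by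
  rw [Real.rpow_neg hx, Real.sqrt_eq_rpow]

theorem norm_productFactor_sq (t : ℝ) (k : ℕ) :
    ‖productFactor N m₀ t k‖ ^ 2 = ‖m₀ ((t / (N : ℝ) ^ k : ℝ) : Torus)‖ ^ 2 / N := by
  rw [productFactor, rpow_neg_half _ (Nat.cast_nonneg N), norm_mul, mul_pow, Complex.norm_real,
    norm_inv, Real.norm_of_nonneg (Real.sqrt_nonneg _), inv_pow, Real.sq_sqrt (Nat.cast_nonneg N)]
  ring

/-- The normalization at 0 makes the limiting factor 1. The ratio 1/2 replaces 1/N so that the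
errors for k ≥ 1 sum to exactly K|t|. -/
theorem norm_productFactor_sub_one_le {K : ℝ} (hN : 2 ≤ N) (hLip : LipschitzBound m₀ K)
    (hm₀ : m₀ 0 = ((√(N : ℝ) : ℝ) : ℂ)) (t : ℝ) (k : ℕ) :
    ‖productFactor N m₀ t k - 1‖ ≤ K * |t| * (1 / 2) ^ k := by
  have hN' : (2 : ℝ) ≤ N := by exact_mod_cast hN
  have hs : 1 ≤ √(N : ℝ) := Real.one_le_sqrt.2 (by linarith)
  have h0 : ((√(N : ℝ) : ℝ) : ℂ) ≠ 0 := by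
    exact_mod_cast (by positivity : √(N : ℝ) ≠ 0)
  have h1 : productFactor N m₀ t k - 1 =
      (((√(N : ℝ))⁻¹ : ℝ) : ℂ) * (m₀ ((t / (N : ℝ) ^ k : ℝ) : Torus) - m₀ ((0 : ℝ) : Torus)) := by
    rw [productFactor, rpow_neg_half _ (Nat.cast_nonneg N), AddCircle.coe_zero, hm₀]
    push_cast
    rw [mul_sub, inv_mul_cancel₀ h0]
  rw [h1, norm_mul, Complex.norm_real, norm_inv, Real.norm_of_nonneg (Real.sqrt_nonneg _)]
  have h2 := hLip.2 (t / (N : ℝ) ^ k) 0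
  rw [sub_zero, abs_div, abs_of_pos (by positivity : (0 : ℝ) < (N : ℝ) ^ k)] at h2
  have h3 : |t| / (N : ℝ) ^ k ≤ |t| * (1 / 2) ^ k := by
    rw [div_eq_mul_inv, one_div, inv_pow]
    gcongr
  calc (√(N : ℝ))⁻¹ * _ ≤ 1 * (K * (|t| / (N : ℝ) ^ k)) := by
        gcongr
        exact inv_le_one_of_one_le₀ hs
    _ ≤ K * |t| * (1 / 2) ^ k := by
        rw [one_mul, mul_assoc]
        have := hLip.1
        gcongr

theorem hasSum_geometric_tail (c : ℝ) : HasSum (fun k : ℕ => c * (1 / 2 : ℝ) ^ (k + 1)) c := by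
  have h := (hasSum_geometric_two.mul_left (c / 2))
  rw [div_mul_cancel₀ c two_ne_zero] at h
  refine h.congr_fun fun k => ?_
  rw [pow_succ]
  ring

theorem multipliable_productFactor {K : ℝ} (hN : 2 ≤ N) (hLip : LipschitzBound m₀ K)
    (hm₀ : m₀ 0 = ((√(N : ℝ) : ℝ) : ℂ)) (t : ℝ) :
    Multipliable fun k : ℕ => productFactor N m₀ t (k + 1) := by
  have h : Summable fun k : ℕ => ‖productFactor N m₀ t (k + 1) - 1‖ :=
    Summable.of_nonneg_of_le (fun _ => norm_nonneg _)
      (fun k => norm_productFactor_sub_one_le hN hLip hm₀ t (k + 1))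
      (hasSum_geometric_tail (K * |t|)).summable
  simpa using multipliable_one_add_of_summable h

/-- The bound vanishes at t = 0, so it yields both the value of Φ at 0 and its continuity there. -/
theorem norm_tprod_productFactor_sub_one_le {K : ℝ} (hN : 2 ≤ N) (hLip : LipschitzBound m₀ K)
    (hm₀ : m₀ 0 = ((√(N : ℝ) : ℝ) : ℂ)) (t : ℝ) :
    ‖∏' k : ℕ, productFactor N m₀ t (k + 1) - 1‖ ≤ Real.exp (K * |t|) - 1 := by
  have h := (multipliable_productFactor hN hLip hm₀ t).hasProd.tendsto_prod_nat
  refine le_of_tendsto ((h.sub_const 1).norm) (Eventually.of_forall fun n => ?_)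
  have h1 := Finset.norm_prod_one_add_sub_one_le (Finset.range n)
    (fun k => productFactor N m₀ t (k + 1) - 1)
  simp only [add_sub_cancel] at h1
  refine h1.trans ?_
  gcongr
  have hs := hasSum_geometric_tail (K * |t|)
  have hK := hLip.1
  calc _ ≤ ∑ k ∈ Finset.range n, K * |t| * (1 / 2) ^ (k + 1) :=
        Finset.sum_le_sum fun k _ => norm_productFactor_sub_one_le hN hLip hm₀ t (k + 1)
    _ ≤ K * |t| := sum_le_hasSum _ (fun k _ => by positivity) hs

theorem norm_two_pi_rpow_sq : ‖(((2 * π) ^ (-(1 / 2) : ℝ) : ℝ) : ℂ)‖ ^ 2 = (2 * π)⁻¹ := by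
  rw [rpow_neg_half _ Real.two_pi_pos.le, Complex.norm_real, norm_inv,
    Real.norm_of_nonneg (Real.sqrt_nonneg _), inv_pow, Real.sq_sqrt Real.two_pi_pos.le]

theorem scalingProduct_zero {K : ℝ} (hN : 2 ≤ N) (hLip : LipschitzBound m₀ K)
    (hm₀ : m₀ 0 = ((√(N : ℝ) : ℝ) : ℂ)) :
    scalingProduct N m₀ 0 = (((2 * π) ^ (-(1 / 2) : ℝ) : ℝ) : ℂ) := by
  have h := norm_tprod_productFactor_sub_one_le hN hLip hm₀ 0
  rw [abs_zero, mul_zero, Real.exp_zero, sub_self, norm_le_zero_iff, sub_eq_zero] at h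
  rw [scalingProduct, h, mul_one]

theorem continuousAt_scalingProduct_zero {K : ℝ} (hN : 2 ≤ N) (hLip : LipschitzBound m₀ K)
    (hm₀ : m₀ 0 = ((√(N : ℝ) : ℝ) : ℂ)) : ContinuousAt (scalingProduct N m₀) 0 := by
  rw [ContinuousAt, scalingProduct_zero hN hLip hm₀]
  have h : Tendsto (fun t : ℝ => ∏' k : ℕ, productFactor N m₀ t (k + 1)) (𝓝 0) (𝓝 1) := by
    rw [tendsto_iff_norm_sub_tendsto_zero]
    refine squeeze_zero (fun _ => norm_nonneg _)
      (fun t => norm_tprod_productFactor_sub_one_le hN hLip hm₀ t) ?_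
    have hc : Continuous fun t : ℝ => Real.exp (K * |t|) - 1 := by fun_prop
    simpa using hc.tendsto 0
  have h1 := h.const_mul (((2 * π) ^ (-(1 / 2) : ℝ) : ℝ) : ℂ)
  rw [mul_one] at h1
  exact h1

theorem productFactor_succ (t : ℝ) (n k : ℕ) :
    productFactor N m₀ t (k + n) = productFactor N m₀ (t / (N : ℝ) ^ n) k := by
  rw [productFactor, productFactor, div_div, pow_add, mul_comm ((N : ℝ) ^ k)]

theorem scalingProduct_eq_prod_mul {K : ℝ} (hN : 2 ≤ N) (hLip : LipschitzBound m₀ K)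
    (hm₀ : m₀ 0 = ((√(N : ℝ) : ℝ) : ℂ)) (t : ℝ) (n : ℕ) :
    scalingProduct N m₀ t = (∏ k ∈ Finset.range n, productFactor N m₀ t (k + 1)) *
      scalingProduct N m₀ (t / (N : ℝ) ^ n) := by
  have h1 : ∀ k, productFactor N m₀ t (k + n + 1) =
      productFactor N m₀ (t / (N : ℝ) ^ n) (k + 1) := fun k => by
    rw [show k + n + 1 = (k + 1) + n by ring, productFactor_succ]
  have h := Multipliable.prod_mul_tprod_nat_mul' (f := fun k => productFactor N m₀ t (k + 1))
    (k := n) (by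
      simp only [h1]
      exact multipliable_productFactor hN hLip hm₀ _)
  simp only [h1] at h
  rw [scalingProduct, scalingProduct, ← h]
  ring

theorem tendsto_div_pow (hN : 2 ≤ N) (t : ℝ) :
    Tendsto (fun n : ℕ => t / (N : ℝ) ^ n) atTop (𝓝 0) := by
  have hN' : (2 : ℝ) ≤ N := by exact_mod_cast hN
  exact tendsto_const_nhds.div_atTop (tendsto_pow_atTop_atTop_of_one_lt (by linarith))

/-- A scaling function which is continuous and normalized at `0` is the infinite product. -/
theorem ae_eq_scalingProduct {K : ℝ} (hN : 2 ≤ N) (hLip : LipschitzBound m₀ K)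
    (hm₀ : m₀ 0 = ((√(N : ℝ) : ℝ) : ℂ)) {ψ : ℝ → ℂ}
    (hscale : ∀ᵐ t : ℝ, ((√(N : ℝ) : ℝ) : ℂ) * ψ (N * t) = m₀ (t : Torus) * ψ t)
    (hcont : ContinuousAt ψ 0) (hψ0 : ψ 0 = (((2 * π) ^ (-(1 / 2) : ℝ) : ℝ) : ℂ)) :
    ψ =ᵐ[volume] scalingProduct N m₀ := by
  have hN0 : (N : ℝ) ≠ 0 := by positivity
  have hs0 : ((√(N : ℝ) : ℝ) : ℂ) ≠ 0 := by exact_mod_cast (by positivity : √(N : ℝ) ≠ 0)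
  -- Dilations preserve null sets, so the scaling relation holds along the whole orbit t/Nⁿ for
  -- almost every t.
  have hall : ∀ᵐ t : ℝ, ∀ n : ℕ,
      ψ (t / (N : ℝ) ^ n) = productFactor N m₀ t (n + 1) * ψ (t / (N : ℝ) ^ (n + 1)) := by
    rw [ae_all_iff]
    intro n
    have hq : Measure.QuasiMeasurePreserving (fun t : ℝ => ((N : ℝ) ^ (n + 1))⁻¹ • t) volume volume :=
      Measure.quasiMeasurePreserving_smul volume (by positivity)
    filter_upwards [hq.ae hscale] with t ht
    have h1 : (N : ℝ) * (((N : ℝ) ^ (n + 1))⁻¹ • t) = t / (N : ℝ) ^ n := by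
      rw [smul_eq_mul, pow_succ]; field_simp
    have h2 : ((N : ℝ) ^ (n + 1))⁻¹ • t = t / (N : ℝ) ^ (n + 1) := by
      rw [smul_eq_mul]; ring
    rw [h1, h2] at ht
    rw [productFactor, rpow_neg_half _ (Nat.cast_nonneg N)]
    push_cast
    rw [mul_assoc, ← ht, inv_mul_cancel_left₀ hs0]
  filter_upwards [hall] with t ht
  have h1 : ∀ n : ℕ, ψ t = (∏ k ∈ Finset.range n, productFactor N m₀ t (k + 1)) *
      ψ (t / (N : ℝ) ^ n) := by
    intro n
    induction n with
    | zero => simp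
    | succ n ih => rw [ih, ht n, Finset.prod_range_succ, mul_assoc]
  have h2 := (multipliable_productFactor hN hLip hm₀ t).hasProd.tendsto_prod_nat
  have h3 : Tendsto (fun n : ℕ => ψ (t / (N : ℝ) ^ n)) atTop (𝓝 (ψ 0)) :=
    hcont.tendsto.comp (tendsto_div_pow hN t)
  have h4 := h2.mul h3
  rw [scalingProduct, mul_comm, ← hψ0]
  exact tendsto_nhds_unique (tendsto_const_nhds.congr fun n => h1 n) h4

/-! ### Periodization and the transfer operator -/

/-- `F` is the periodization of `g`. -/
def HasPER (g : ℝ → ℂ) (G : Torus → ℂ) : Prop :=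
  ∀ t : ℝ, HasSum (fun k : ℤ => g (t + 2 * π * k)) (G (t : Torus))

/-- The transfer operator on arbitrary functions. -/
def transfer (N : ℕ) (m₀ : C(Torus, ℂ)) (G : Torus → ℂ) (z : Torus) : ℂ :=
  (1 / (N : ℂ)) * preimageSum N (fun w => ((‖m₀ w‖ ^ 2 : ℝ) : ℂ) * G w) z

theorem transfer_coe (hN : 2 ≤ N) (G : Torus → ℂ) (t : ℝ) :
    transfer N m₀ G (t : Torus) = ∑ k ∈ Finset.range N,
      ((‖m₀ (((t + 2 * π * k) / N : ℝ) : Torus)‖ ^ 2 / N : ℝ) : ℂ) *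
        G (((t + 2 * π * k) / N : ℝ) : Torus) := by
  rw [transfer, preimageSum_coe hN, Finset.mul_sum]
  refine Finset.sum_congr rfl fun k _ => ?_
  push_cast
  ring

/-- The lift of the transfer operator along the periodization. -/
def refinement (N : ℕ) (m₀ : C(Torus, ℂ)) (χ : ℝ → ℂ) (t : ℝ) : ℂ :=
  ((‖m₀ ((t / N : ℝ) : Torus)‖ ^ 2 / N : ℝ) : ℂ) * χ (t / N)

theorem hasSum_int_of_residues {a : ℤ → ℂ} {s : ℕ → ℂ} (hN : N ≠ 0)
    (h : ∀ j ∈ Finset.range N, HasSum (fun l : ℤ => a (j + N * l)) (s j)) :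
    HasSum a (∑ j ∈ Finset.range N, s j) := by
  have hNz : (N : ℤ) ≠ 0 := by exact_mod_cast hN
  -- Extend the series over each residue class by zero to all of ℤ; then only a finite sum of series
  -- remains.
  have h1 : ∀ j ∈ Finset.range N,
      HasSum (fun k : ℤ => if k % N = j then a k else 0) (s j) := by
    intro j hj
    have hjN : j < N := Finset.mem_range.1 hj
    have hinj : Function.Injective fun l : ℤ => (j : ℤ) + N * l := by
      intro l l' hl
      exact mul_left_cancel₀ hNz (add_left_cancel hl)
    rw [← hinj.hasSum_iff]
    · convert h j hj using 2 with l
      have : ((j : ℤ) + N * l) % N = j := by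
        rw [Int.add_mul_emod_self_left]
        exact Int.emod_eq_of_lt (by positivity) (by exact_mod_cast hjN)
      simp [this]
    · intro k hk
      rw [if_neg]
      intro hkj
      exact hk ⟨k / N, by simp only [← hkj]; exact Int.emod_add_mul_ediv k N⟩
  convert hasSum_sum h1 using 2 with k
  have hk0 := Int.emod_nonneg k hNz
  have hk1 := Int.emod_lt_of_pos k (by omega : (0 : ℤ) < N)
  rw [Finset.sum_eq_single (k % N).toNat]
  · rw [if_pos (Int.toNat_of_nonneg hk0).symm]
  · intro b _ hb
    rw [if_neg]
    intro hb'
    exact hb (by omega)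
  · intro hb
    exact absurd (Finset.mem_range.2 (by omega)) hb

theorem coe_add_two_pi_mul (t : ℝ) (l : ℤ) : ((t + 2 * π * l : ℝ) : Torus) = (t : Torus) :=
  (coe_eq_coe_iff _ _).2 ⟨l, by ring⟩

/-- Writing k = j + Nl, a shift of t by 2πk becomes, after division by N, a shift of the j-th root
by 2πl. The hypothesis concerns a single t so that it also applies when the periodization is known
only almost everywhere. -/
theorem hasSum_refinement (hN : 2 ≤ N) {χ : ℝ → ℂ} {G : Torus → ℂ} {t : ℝ}
    (h : ∀ j ∈ Finset.range N, HasSum (fun l : ℤ => χ ((t + 2 * π * j) / N + 2 * π * l))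
      (G (((t + 2 * π * j) / N : ℝ) : Torus))) :
    HasSum (fun k : ℤ => refinement N m₀ χ (t + 2 * π * k)) (transfer N m₀ G (t : Torus)) := by
  have hN0 : (N : ℝ) ≠ 0 := by positivity
  rw [transfer_coe hN]
  refine hasSum_int_of_residues (by omega) fun j hj => ?_
  refine ((h j hj).mul_left _).congr_fun fun l => ?_
  have h1 : (t + 2 * π * ((j + N * l : ℤ) : ℝ)) / N = (t + 2 * π * j) / N + 2 * π * l := by
    push_cast
    field_simp
    ring
  rw [refinement, h1, coe_add_two_pi_mul]

theorem HasPER.transfer_refinement (hN : 2 ≤ N) {χ : ℝ → ℂ} {G : Torus → ℂ} (h : HasPER χ G) :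
    HasPER (refinement N m₀ χ) (transfer N m₀ G) :=
  fun _ => hasSum_refinement hN fun _ _ => h _

/-- `P_n(t) = ∏_{k ≤ n} |N^{-1/2} m₀(t N^{-k})|²`. -/
def truncatedProduct (N : ℕ) (m₀ : C(Torus, ℂ)) (n : ℕ) (t : ℝ) : ℝ :=
  ∏ k ∈ Finset.range n, ‖productFactor N m₀ t (k + 1)‖ ^ 2

theorem truncatedProduct_nonneg (n : ℕ) (t : ℝ) : 0 ≤ truncatedProduct N m₀ n t :=
  Finset.prod_nonneg fun _ _ => by positivity

theorem iterate_refinement (χ : ℝ → ℂ) (n : ℕ) (t : ℝ) :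
    (refinement N m₀)^[n] χ t =
      ((truncatedProduct N m₀ n t : ℝ) : ℂ) * χ (t / (N : ℝ) ^ n) := by
  induction n generalizing t with
  | zero => simp [truncatedProduct]
  | succ n ih =>
    -- The outermost application supplies the factor k = 1; the earlier ones, evaluated at t/N,
    -- supply the factors k ≥ 2.
    rw [Function.iterate_succ_apply', refinement, ih, truncatedProduct, truncatedProduct,
      Finset.prod_range_succ', norm_productFactor_sq]
    have h1 : ∀ k, productFactor N m₀ t (k + 1 + 1) = productFactor N m₀ (t / N) (k + 1) :=
      fun k => by rw [productFactor_succ t 1 (k + 1), pow_one]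
    simp only [h1, zero_add, pow_one]
    rw [pow_succ' (N : ℝ) n, ← div_div]
    push_cast
    ring

theorem HasPER.iterate (hN : 2 ≤ N) {χ : ℝ → ℂ} {ξ : C(Torus, ℂ)} (h : HasPER χ ξ) (n : ℕ) :
    HasPER ((refinement N m₀)^[n] χ) ((transferOperator hN m₀ ^ n) ξ) := by
  induction n with
  | zero => simpa using h
  | succ n ih =>
    rw [Function.iterate_succ_apply', pow_succ']
    exact ih.transfer_refinement hN

theorem norm_scalingProduct_sq {K : ℝ} (hN : 2 ≤ N) (hLip : LipschitzBound m₀ K)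
    (hm₀ : m₀ 0 = ((√(N : ℝ) : ℝ) : ℂ)) (t : ℝ) (n : ℕ) :
    ‖scalingProduct N m₀ t‖ ^ 2 = truncatedProduct N m₀ n t *
      ‖scalingProduct N m₀ (t / (N : ℝ) ^ n)‖ ^ 2 := by
  rw [scalingProduct_eq_prod_mul hN hLip hm₀ t n, norm_mul, mul_pow, norm_prod, ← Finset.prod_pow,
    truncatedProduct]

theorem tendsto_truncatedProduct {K : ℝ} (hN : 2 ≤ N) (hLip : LipschitzBound m₀ K)
    (hm₀ : m₀ 0 = ((√(N : ℝ) : ℝ) : ℂ)) (t : ℝ) :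
    Tendsto (fun n => truncatedProduct N m₀ n t) atTop
      (𝓝 (2 * π * ‖scalingProduct N m₀ t‖ ^ 2)) := by
  have h := ((multipliable_productFactor hN hLip hm₀ t).hasProd.tendsto_prod_nat.norm).pow 2
  have h1 : 2 * π * ‖scalingProduct N m₀ t‖ ^ 2 =
      ‖∏' k : ℕ, productFactor N m₀ t (k + 1)‖ ^ 2 := by
    rw [scalingProduct, norm_mul, mul_pow, norm_two_pi_rpow_sq,
      mul_inv_cancel_left₀ Real.two_pi_pos.ne']
  rw [h1]
  refine h.congr fun n => ?_
  rw [norm_prod, truncatedProduct, Finset.prod_pow]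

theorem refinement_scalingProduct {K : ℝ} (hN : 2 ≤ N) (hLip : LipschitzBound m₀ K)
    (hm₀ : m₀ 0 = ((√(N : ℝ) : ℝ) : ℂ)) :
    refinement N m₀ (fun t => ((‖scalingProduct N m₀ t‖ ^ 2 : ℝ) : ℂ)) =
      fun t => ((‖scalingProduct N m₀ t‖ ^ 2 : ℝ) : ℂ) := by
  ext t
  rw [norm_scalingProduct_sq hN hLip hm₀ t 1, refinement, truncatedProduct,
    Finset.prod_range_one, norm_productFactor_sq]
  push_cast
  simp

/-! ### The quadrature condition -/

/-- The quadrature condition at every point. -/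
def Quadrature (N : ℕ) (m₀ : C(Torus, ℂ)) : Prop :=
  ∀ z : Torus, preimageSum N (fun w => ((‖m₀ w‖ ^ 2 : ℝ) : ℂ)) z = N

theorem quadratureCondition_iff (hN : 2 ≤ N) : QuadratureCondition N m₀ ↔ Quadrature N m₀ := by
  refine ⟨fun h => ?_, fun h => Eventually.of_forall h⟩
  have hc : Continuous (preimageSum N (fun w => ((‖m₀ w‖ ^ 2 : ℝ) : ℂ))) :=
    continuous_preimageSum hN (by fun_prop)
  have := (hc.ae_eq_iff_eq AddCircle.haarAddCircle continuous_const).1 h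
  exact fun z => congrFun this z

theorem quadrature_of_ae (hN : 2 ≤ N)
    (h : ∀ᵐ t : ℝ, preimageSum N (fun w => ((‖m₀ w‖ ^ 2 : ℝ) : ℂ)) (t : Torus) = N) :
    Quadrature N m₀ := by
  have hc : Continuous (fun t : ℝ => preimageSum N (fun w => ((‖m₀ w‖ ^ 2 : ℝ) : ℂ)) (t : Torus)) :=
    (continuous_preimageSum hN (by fun_prop)).comp (AddCircle.continuous_mk' (2 * π))
  have h1 := (hc.ae_eq_iff_eq volume continuous_const).1 h
  intro z
  induction z using QuotientAddGroup.induction_on with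
  | H t => exact congrFun h1 t

theorem transfer_const (hN : 2 ≤ N) (hq : Quadrature N m₀) (c : ℂ) (z : Torus) :
    transfer N m₀ (fun _ => c) z = c := by
  have hN0 : (N : ℂ) ≠ 0 := by exact_mod_cast (by omega : N ≠ 0)
  induction z using QuotientAddGroup.induction_on with
  | H t =>
    have h := hq (t : Torus)
    rw [preimageSum_coe hN] at h
    change transfer N m₀ _ ((t : ℝ) : Torus) = c
    rw [transfer, preimageSum_coe hN, ← Finset.sum_mul, h]
    field_simp

theorem quadrature_of_transfer_const (hN : 2 ≤ N) {c : ℂ} (hc : c ≠ 0) {t : ℝ}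
    (h : transfer N m₀ (fun _ => c) (t : Torus) = c) :
    preimageSum N (fun w => ((‖m₀ w‖ ^ 2 : ℝ) : ℂ)) (t : Torus) = N := by
  have hN0 : (N : ℂ) ≠ 0 := by exact_mod_cast (by omega : N ≠ 0)
  rw [transfer, preimageSum_coe hN, ← Finset.sum_mul] at h
  rw [preimageSum_coe hN]
  field_simp at h
  exact h

/-- The weights |m₀(w)|²/N form a probability vector on each fibre, so R averages; the sup-norm and
Lipschitz estimates rest on this. -/
theorem Quadrature.sum_eq_one (hN : 2 ≤ N) (hq : Quadrature N m₀) (t : ℝ) :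
    ∑ k ∈ Finset.range N, ‖m₀ (((t + 2 * π * k) / N : ℝ) : Torus)‖ ^ 2 / (N : ℝ) = 1 := by
  have h := transfer_const hN hq 1 (t : Torus)
  rw [transfer_coe hN] at h
  simp only [mul_one] at h
  exact_mod_cast h

/-- Apply quadrature at Nt, one of whose roots is t, and drop the other nonnegative terms. -/
theorem Quadrature.norm_le_sqrt (hN : 2 ≤ N) (hq : Quadrature N m₀) (z : Torus) :
    ‖m₀ z‖ ≤ √N := by
  have hN0 : (N : ℝ) ≠ 0 := by positivity
  refine Real.le_sqrt_of_sq_le ?_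
  induction z using QuotientAddGroup.induction_on with
  | H t =>
    have h := hq.sum_eq_one hN (N * t)
    rw [← Finset.sum_div, div_eq_one_iff_eq hN0] at h
    have h1 := Finset.single_le_sum (s := Finset.range N)
      (f := fun k : ℕ => ‖m₀ (((N * t + 2 * π * k) / N : ℝ) : Torus)‖ ^ 2)
      (fun _ _ => by positivity) (Finset.mem_range.2 (by omega : 0 < N))
    rw [h] at h1
    simp only [Nat.cast_zero, mul_zero, add_zero, mul_div_cancel_left₀ t hN0] at h1
    exact h1

theorem Quadrature.norm_transfer_le (hN : 2 ≤ N) (hq : Quadrature N m₀) {G : Torus → ℂ} {C : ℝ}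
    (hG : ∀ z, ‖G z‖ ≤ C) (z : Torus) : ‖transfer N m₀ G z‖ ≤ C := by
  induction z using QuotientAddGroup.induction_on with
  | H t =>
    rw [transfer_coe hN]
    calc _ ≤ ∑ k ∈ Finset.range N, ‖m₀ (((t + 2 * π * k) / N : ℝ) : Torus)‖ ^ 2 / (N : ℝ) * C := by
          refine norm_sum_le_of_le _ fun k _ => ?_
          rw [norm_mul, Complex.norm_real, Real.norm_of_nonneg (by positivity)]
          exact mul_le_mul_of_nonneg_left (hG _) (by positivity)
      _ = C := by rw [← Finset.sum_mul, hq.sum_eq_one hN, one_mul]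

theorem Quadrature.norm_pow_le (hN : 2 ≤ N) (hq : Quadrature N m₀) {ξ : C(Torus, ℂ)} {C : ℝ}
    (hξ : ∀ z, ‖ξ z‖ ≤ C) (n : ℕ) (z : Torus) : ‖(transferOperator hN m₀ ^ n) ξ z‖ ≤ C := by
  induction n generalizing z with
  | zero => simpa using hξ z
  | succ n ih =>
    rw [pow_succ']
    exact hq.norm_transfer_le hN ih z

/-- The transfer operator contracts Lipschitz constants up to a bounded term. -/
theorem Quadrature.lipschitz_transfer {K : ℝ} (hN : 2 ≤ N) (hLip : LipschitzBound m₀ K)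
    (hq : Quadrature N m₀) {G : Torus → ℂ} (hG : ∀ z, ‖G z‖ ≤ 1) {L : ℝ}
    (hL : 4 * K * √N ≤ L) (h : ∀ t s : ℝ, ‖G (t : Torus) - G (s : Torus)‖ ≤ L * |t - s|)
    (t s : ℝ) : ‖transfer N m₀ G (t : Torus) - transfer N m₀ G (s : Torus)‖ ≤ L * |t - s| := by
  have hN' : (2 : ℝ) ≤ N := by exact_mod_cast hN
  have hN0 : (N : ℝ) ≠ 0 := by positivity
  have hK := hLip.1
  have hL0 : 0 ≤ L := le_trans (by positivity) hL
  have hd : ∀ k : ℕ, |(t + 2 * π * k) / N - (s + 2 * π * k) / N| = |t - s| / N := fun k => by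
    rw [← sub_div, abs_div, Nat.abs_cast, add_sub_add_right_eq_sub]
  rw [transfer_coe hN, transfer_coe hN, ← Finset.sum_sub_distrib]
  calc _ ≤ ∑ k ∈ Finset.range N,
        (‖m₀ (((t + 2 * π * k) / N : ℝ) : Torus)‖ ^ 2 / (N : ℝ) * (L * (|t - s| / N)) +
          2 * √N * (K * (|t - s| / N)) / N) := by
        refine norm_sum_le_of_le _ fun k _ => ?_
        set a := (t + 2 * π * k) / N with ha
        set b := (s + 2 * π * k) / N with hb
        have hab : |a - b| = |t - s| / N := hd k
        -- Separate the variation of G, averaged by the weights, from the variation of the weights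
        -- themselves.
        have e : ((‖m₀ (a : Torus)‖ ^ 2 / N : ℝ) : ℂ) * G (a : Torus) -
            ((‖m₀ (b : Torus)‖ ^ 2 / N : ℝ) : ℂ) * G (b : Torus) =
            ((‖m₀ (a : Torus)‖ ^ 2 / N : ℝ) : ℂ) * (G (a : Torus) - G (b : Torus)) +
            (((‖m₀ (a : Torus)‖ ^ 2 - ‖m₀ (b : Torus)‖ ^ 2) / N : ℝ) : ℂ) * G (b : Torus) := by
          push_cast
          ring
        rw [e]
        refine (norm_add_le _ _).trans (add_le_add ?_ ?_)
        · rw [norm_mul, Complex.norm_real, Real.norm_of_nonneg (by positivity), ← hab]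
          exact mul_le_mul_of_nonneg_left (h a b) (by positivity)
        · rw [norm_mul, Complex.norm_real, Real.norm_eq_abs, abs_div, Nat.abs_cast, sq_sub_sq,
            abs_mul, ← hab]
          have h1 : |‖m₀ (a : Torus)‖ + ‖m₀ (b : Torus)‖| ≤ 2 * √N := by
            rw [abs_of_nonneg (by positivity)]
            linarith [hq.norm_le_sqrt hN a, hq.norm_le_sqrt hN b]
          have h2 : |‖m₀ (a : Torus)‖ - ‖m₀ (b : Torus)‖| ≤ K * |a - b| :=
            (abs_norm_sub_norm_le _ _).trans (hLip.2 a b)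
          refine (mul_le_of_le_one_right (by positivity) (hG _)).trans ?_
          gcongr
    _ = L * (|t - s| / N) + 2 * √N * (K * (|t - s| / N)) := by
        rw [Finset.sum_add_distrib, ← Finset.sum_mul, hq.sum_eq_one hN, Finset.sum_const,
          Finset.card_range, nsmul_eq_mul, one_mul, mul_div_cancel₀ _ hN0]
    _ = (L + 2 * K * √N) / N * |t - s| := by ring
    _ ≤ L * |t - s| := by
        -- Since 2K√N ≤ L/2 and N ≥ 2, the coefficient is at most 3L/4.
        gcongr
        rw [div_le_iff₀ (by positivity)]
        nlinarith

/-! ### A bump function at the identity -/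

/-- The tent function of width `δ`. -/
def tent (δ t : ℝ) : ℝ := max 0 (1 - |t| / δ)

/-- The periodized tent function. -/
def bump (δ : ℝ) : C(Torus, ℂ) where
  toFun z := ((max 0 (1 - ‖z‖ / δ) : ℝ) : ℂ)
  continuous_toFun := by fun_prop

theorem bump_apply (δ : ℝ) (z : Torus) : bump δ z = ((max 0 (1 - ‖z‖ / δ) : ℝ) : ℂ) := rfl

theorem bump_zero (δ : ℝ) : bump δ 0 = 1 := by simp [bump_apply]

theorem norm_bump_le {δ : ℝ} (hδ : 0 < δ) (z : Torus) : ‖bump δ z‖ ≤ 1 := by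
  rw [bump_apply, Complex.norm_real, Real.norm_of_nonneg (le_max_left _ _)]
  exact max_le zero_le_one (by have : 0 ≤ ‖z‖ / δ := by positivity
                               linarith)

theorem norm_one_sub_bump {δ : ℝ} (hδ : 0 < δ) (z : Torus) :
    ‖1 - bump δ z‖ = 1 - (bump δ z).re := by
  have h := norm_bump_le hδ z
  rw [bump_apply, Complex.norm_real, Real.norm_of_nonneg (le_max_left _ _)] at h
  rw [bump_apply, ← Complex.ofReal_one, ← Complex.ofReal_sub, Complex.norm_real, Complex.ofReal_re,
    Real.norm_of_nonneg (by linarith)]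

theorem bump_lipschitz {δ : ℝ} (hδ : 0 < δ) (t s : ℝ) :
    ‖bump δ (t : Torus) - bump δ (s : Torus)‖ ≤ δ⁻¹ * |t - s| := by
  rw [bump_apply, bump_apply, ← Complex.ofReal_sub, Complex.norm_real, Real.norm_eq_abs]
  have h1 : |‖(t : Torus)‖ - ‖(s : Torus)‖| ≤ |t - s| := by
    refine (abs_norm_sub_norm_le _ _).trans ?_
    rw [← AddCircle.coe_sub]
    exact QuotientAddGroup.norm_mk_le_norm
  calc _ ≤ |(1 - ‖(t : Torus)‖ / δ) - (1 - ‖(s : Torus)‖ / δ)| := by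
        simpa only [max_comm] using abs_max_sub_max_le_abs (1 - ‖(t : Torus)‖ / δ) (1 - ‖(s : Torus)‖ / δ) 0
    _ = δ⁻¹ * |‖(t : Torus)‖ - ‖(s : Torus)‖| := by
        rw [sub_sub_sub_cancel_left, ← sub_div, abs_div, abs_of_pos hδ, abs_sub_comm]
        ring
    _ ≤ δ⁻¹ * |t - s| := by gcongr

theorem tent_nonneg (δ t : ℝ) : 0 ≤ tent δ t := le_max_left _ _

theorem tent_le_one {δ : ℝ} (hδ : 0 < δ) (t : ℝ) : tent δ t ≤ 1 :=
  max_le zero_le_one (by have : 0 ≤ |t| / δ := by positivity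
                         linarith)

theorem continuous_tent (δ : ℝ) : Continuous (tent δ) := by unfold tent; fun_prop

theorem tent_eq_zero {δ t : ℝ} (hδ : 0 < δ) (h : δ ≤ |t|) : tent δ t = 0 :=
  max_eq_left (by rw [sub_nonpos]; exact (one_le_div hδ).2 h)

/-- As δ ≤ π, at most one translate of the tent is nonzero at any point: the one at the
representative of t nearest to 0, whose absolute value is the norm on the circle. -/
theorem hasPER_tent {δ : ℝ} (hδ : 0 < δ) (hδπ : δ ≤ π) (f : C(Torus, ℂ)) :
    HasPER (fun t => (tent δ t : ℂ) * f (t : Torus)) (bump δ * f : C(Torus, ℂ)) := by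
  intro t
  have h1 : HasSum (fun k : ℤ => ((tent δ (t + 2 * π * k) : ℝ) : ℂ)) (bump δ (t : Torus)) := by
    set r := round ((2 * π)⁻¹ * t) with hr
    have hn : ‖(t : Torus)‖ = |t + 2 * π * ((-r : ℤ) : ℝ)| := by
      rw [AddCircle.norm_eq, ← hr]
      push_cast
      ring_nf
    have h2 : bump δ (t : Torus) = ((tent δ (t + 2 * π * ((-r : ℤ) : ℝ)) : ℝ) : ℂ) := by
      rw [bump_apply, hn, tent]
    rw [h2]
    refine hasSum_single (-r) fun k hk => ?_
    rw [tent_eq_zero hδ, Complex.ofReal_zero]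
    refine hδπ.trans ?_
    have h3 : |t + 2 * π * ((-r : ℤ) : ℝ)| ≤ π := by
      rw [← hn]
      have := AddCircle.norm_le_half_period (2 * π) (x := (t : Torus)) Real.two_pi_pos.ne'
      rw [abs_of_pos Real.two_pi_pos] at this
      linarith
    have h4 : (1 : ℝ) ≤ |((k - -r : ℤ) : ℝ)| := by
      exact_mod_cast Int.one_le_abs (sub_ne_zero.2 hk)
    have h5 : t + 2 * π * k = (t + 2 * π * ((-r : ℤ) : ℝ)) + 2 * π * ((k - -r : ℤ) : ℝ) := by
      push_cast
      ring
    have h6 : 2 * π ≤ |2 * π * ((k - -r : ℤ) : ℝ)| := by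
      rw [abs_mul, abs_of_pos Real.two_pi_pos]
      nlinarith [Real.pi_pos]
    rw [h5]
    have h7 := abs_sub_abs_le_abs_add (2 * π * ((k - -r : ℤ) : ℝ)) (t + 2 * π * ((-r : ℤ) : ℝ))
    rw [add_comm (2 * π * ((k - -r : ℤ) : ℝ))] at h7
    linarith
  have h8 := h1.mul_right (f (t : Torus))
  refine h8.congr_fun fun k => ?_
  simp only [coe_add_two_pi_mul]

/-! ### Powers of the transfer operator and the periodization of `|Φ|²` -/

/-- Turns Rⁿ(uf) into an explicit series over ℤ, to which limit theorems for series apply. -/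
theorem hasSum_pow_bump (hN : 2 ≤ N) {δ : ℝ} (hδ : 0 < δ) (hδπ : δ ≤ π) (f : C(Torus, ℂ))
    (n : ℕ) (t : ℝ) :
    HasSum (fun k : ℤ => ((truncatedProduct N m₀ n (t + 2 * π * k) : ℝ) : ℂ) *
      ((tent δ ((t + 2 * π * k) / (N : ℝ) ^ n) : ℂ) *
        f (((t + 2 * π * k) / (N : ℝ) ^ n : ℝ) : Torus)))
      ((transferOperator hN m₀ ^ n) (bump δ * f) (t : Torus)) := by
  refine ((hasPER_tent hδ hδπ f).iterate (m₀ := m₀) hN n t).congr_fun fun k => ?_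
  rw [iterate_refinement]

theorem tendsto_truncatedProduct_mul {K : ℝ} (hN : 2 ≤ N) (hLip : LipschitzBound m₀ K)
    (hm₀ : m₀ 0 = ((√(N : ℝ) : ℝ) : ℂ)) (δ : ℝ) (f : C(Torus, ℂ)) (t : ℝ) :
    Tendsto (fun n => ((truncatedProduct N m₀ n t : ℝ) : ℂ) *
      ((tent δ (t / (N : ℝ) ^ n) : ℂ) * f ((t / (N : ℝ) ^ n : ℝ) : Torus))) atTop
      (𝓝 (((2 * π * ‖scalingProduct N m₀ t‖ ^ 2 : ℝ) : ℂ) * f 0)) := by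
  have h1 : Tendsto (fun n => ((truncatedProduct N m₀ n t : ℝ) : ℂ)) atTop
      (𝓝 ((2 * π * ‖scalingProduct N m₀ t‖ ^ 2 : ℝ) : ℂ)) :=
    (Complex.continuous_ofReal.tendsto _).comp (tendsto_truncatedProduct hN hLip hm₀ t)
  have hc : Continuous fun s : ℝ => (tent δ s : ℂ) * f (s : Torus) :=
    (Complex.continuous_ofReal.comp (continuous_tent δ)).mul
      (f.continuous.comp (AddCircle.continuous_mk' (2 * π)))
  have h2 := (hc.tendsto 0).comp (tendsto_div_pow hN t)
  have h3 : (tent δ 0 : ℂ) * f ((0 : ℝ) : Torus) = f 0 := by simp [tent]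
  rw [h3] at h2
  exact h1.mul h2

/-- A Fatou argument: a finite part of the series for Rⁿu is at most Rⁿu ≤ 1, and n tends to
infinity. No lower bound on Φ is needed, so the tent may have width π. -/
theorem Quadrature.sum_norm_sq_le {K : ℝ} (hN : 2 ≤ N) (hLip : LipschitzBound m₀ K)
    (hm₀ : m₀ 0 = ((√(N : ℝ) : ℝ) : ℂ)) (hq : Quadrature N m₀) (t : ℝ) (S : Finset ℤ) :
    ∑ k ∈ S, 2 * π * ‖scalingProduct N m₀ (t + 2 * π * k)‖ ^ 2 ≤ 1 := by
  have h1 : Tendsto (fun n => ∑ k ∈ S, (((truncatedProduct N m₀ n (t + 2 * π * k) : ℝ) : ℂ) *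
      ((tent π ((t + 2 * π * k) / (N : ℝ) ^ n) : ℂ) *
        (1 : C(Torus, ℂ)) (((t + 2 * π * k) / (N : ℝ) ^ n : ℝ) : Torus))).re) atTop
      (𝓝 (∑ k ∈ S, 2 * π * ‖scalingProduct N m₀ (t + 2 * π * k)‖ ^ 2)) := by
    refine tendsto_finsetSum S fun k _ => ?_
    have h2 := (Complex.continuous_re.tendsto _).comp
      (tendsto_truncatedProduct_mul hN hLip hm₀ π 1 (t + 2 * π * k))
    rw [ContinuousMap.one_apply, mul_one, Complex.ofReal_re] at h2
    exact h2
  refine le_of_tendsto h1 (Eventually.of_forall fun n => ?_)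
  have h3 := Complex.hasSum_re (hasSum_pow_bump (m₀ := m₀) hN Real.pi_pos le_rfl 1 n t)
  refine (sum_le_hasSum S (fun k _ => ?_) h3).trans ?_
  · rw [ContinuousMap.one_apply, mul_one, ← Complex.ofReal_mul, Complex.ofReal_re]
    exact mul_nonneg (truncatedProduct_nonneg _ _) (tent_nonneg _ _)
  · refine (Complex.re_le_norm _).trans (hq.norm_pow_le hN (fun z => ?_) n _)
    rw [mul_one]
    exact norm_bump_le Real.pi_pos z

theorem Quadrature.summable {K : ℝ} (hN : 2 ≤ N) (hLip : LipschitzBound m₀ K)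
    (hm₀ : m₀ 0 = ((√(N : ℝ) : ℝ) : ℂ)) (hq : Quadrature N m₀) (t : ℝ) :
    Summable fun k : ℤ => ‖scalingProduct N m₀ (t + 2 * π * k)‖ ^ 2 := by
  have h := summable_of_sum_le (fun k => by positivity) (hq.sum_norm_sq_le hN hLip hm₀ t)
  exact (summable_mul_left_iff Real.two_pi_pos.ne').1 h

/-- `2π PER(|Φ|²)`, as a function on the circle. -/
def periodizedSq (N : ℕ) (m₀ : C(Torus, ℂ)) : Torus → ℝ :=
  Function.Periodic.lift (f := fun t => 2 * π * PER (fun s => ‖scalingProduct N m₀ s‖ ^ 2) t)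
    (c := 2 * π) fun t => by
      unfold PER
      beta_reduce
      rw [← (Equiv.addLeft (1 : ℤ)).tsum_eq (fun k : ℤ =>
        ‖scalingProduct N m₀ (t + 2 * π * k)‖ ^ 2)]
      congr 2
      ext k
      rw [Equiv.coe_addLeft]
      push_cast
      rw [mul_add, mul_one, add_assoc]

theorem periodizedSq_coe (t : ℝ) : periodizedSq N m₀ (t : Torus) =
    2 * π * PER (fun s => ‖scalingProduct N m₀ s‖ ^ 2) t := rfl

theorem Quadrature.periodizedSq_le_one {K : ℝ} (hN : 2 ≤ N) (hLip : LipschitzBound m₀ K)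
    (hm₀ : m₀ 0 = ((√(N : ℝ) : ℝ) : ℂ)) (hq : Quadrature N m₀) (z : Torus) :
    periodizedSq N m₀ z ≤ 1 := by
  induction z using QuotientAddGroup.induction_on with
  | H t =>
    change 2 * π * PER _ t ≤ 1
    rw [PER, ← tsum_mul_left]
    exact Real.tsum_le_of_sum_le (fun k => by positivity) (hq.sum_norm_sq_le hN hLip hm₀ t)

/-- The bound is half of |Φ(0)|² = 1/(2π), so it persists near 0 by continuity. -/
theorem exists_lower_bound_scalingProduct {K : ℝ} (hN : 2 ≤ N) (hLip : LipschitzBound m₀ K)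
    (hm₀ : m₀ 0 = ((√(N : ℝ) : ℝ) : ℂ)) :
    ∃ δ : ℝ, 0 < δ ∧ δ ≤ π ∧ ∀ s, |s| < δ → (4 * π)⁻¹ ≤ ‖scalingProduct N m₀ s‖ ^ 2 := by
  have h := (continuousAt_scalingProduct_zero hN hLip hm₀).tendsto.norm.pow 2
  rw [scalingProduct_zero hN hLip hm₀, norm_two_pi_rpow_sq] at h
  have h1 : (4 * π)⁻¹ < (2 * π)⁻¹ := by
    have := Real.pi_pos
    gcongr
    norm_num
  obtain ⟨ε, hε, h2⟩ := Metric.eventually_nhds_iff.1 (h.eventually_const_lt h1)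
  refine ⟨min ε π, lt_min hε Real.pi_pos, min_le_right _ _, fun s hs => ?_⟩
  refine (h2 ?_).le
  rw [Real.dist_eq, sub_zero]
  exact hs.trans_le (min_le_left _ _)

/-- `Rⁿ(u f) → f(0) · 2π PER(|Φ|²)` pointwise, for a bump function `u` with small support. -/
theorem Quadrature.tendsto_pow_bump_mul {K : ℝ} (hN : 2 ≤ N) (hLip : LipschitzBound m₀ K)
    (hm₀ : m₀ 0 = ((√(N : ℝ) : ℝ) : ℂ)) (hq : Quadrature N m₀) {δ : ℝ} (hδ : 0 < δ) (hδπ : δ ≤ π)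
    (hδΦ : ∀ s, |s| < δ → (4 * π)⁻¹ ≤ ‖scalingProduct N m₀ s‖ ^ 2) (f : C(Torus, ℂ))
    (z : Torus) :
    Tendsto (fun n => (transferOperator hN m₀ ^ n) (bump δ * f) z) atTop
      (𝓝 (periodizedSq N m₀ z * f 0)) := by
  induction z using QuotientAddGroup.induction_on with
  | H t =>
    have hlim : (periodizedSq N m₀ (t : Torus) : ℂ) * f 0 = ∑' k : ℤ,
        ((2 * π * ‖scalingProduct N m₀ (t + 2 * π * k)‖ ^ 2 : ℝ) : ℂ) * f 0 := by
      rw [periodizedSq_coe, PER, ← tsum_mul_left, Complex.ofReal_tsum, tsum_mul_right]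
    rw [hlim]
    have hs : Summable fun k : ℤ =>
        4 * π * ‖f‖ * ‖scalingProduct N m₀ (t + 2 * π * k)‖ ^ 2 :=
      (hq.summable hN hLip hm₀ t).mul_left _
    refine (tendsto_tsum_of_dominated_convergence hs
      (fun k => tendsto_truncatedProduct_mul hN hLip hm₀ δ f (t + 2 * π * k))
      (Eventually.of_forall fun n k => ?_)).congr
      fun n => (hasSum_pow_bump (m₀ := m₀) hN hδ hδπ f n t).tsum_eq
    set s := t + 2 * π * (k : ℝ)
    have hpi := Real.pi_pos
    have hP := truncatedProduct_nonneg (N := N) (m₀ := m₀) n s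
    -- Either the tent vanishes, or s/Nⁿ lies where |Φ|² ≥ 1/(4π), so the partial product at s is at
    -- most 4π|Φ(s)|².
    rcases le_or_gt δ |s / (N : ℝ) ^ n| with h | h
    · rw [tent_eq_zero hδ h, Complex.ofReal_zero, zero_mul, mul_zero, norm_zero]
      positivity
    · rw [norm_mul, norm_mul, Complex.norm_real, Complex.norm_real, Real.norm_of_nonneg hP,
        Real.norm_of_nonneg (tent_nonneg _ _), norm_scalingProduct_sq hN hLip hm₀ s n]
      have h1 := hδΦ _ h
      have h2 : 1 ≤ 4 * π * ‖scalingProduct N m₀ (s / (N : ℝ) ^ n)‖ ^ 2 := by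
        rw [inv_le_iff_one_le_mul₀ (by positivity)] at h1
        linarith
      have h3 : tent δ (s / (N : ℝ) ^ n) * ‖f ((s / (N : ℝ) ^ n : ℝ) : Torus)‖ ≤ 1 * ‖f‖ :=
        mul_le_mul (tent_le_one hδ _) (f.norm_coe_le_norm _) (norm_nonneg _) zero_le_one
      calc _ ≤ truncatedProduct N m₀ n s * (1 * ‖f‖) := by gcongr
        _ ≤ truncatedProduct N m₀ n s *
            ((4 * π * ‖scalingProduct N m₀ (s / (N : ℝ) ^ n)‖ ^ 2) * ‖f‖) := by gcongr
        _ = _ := by ring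

/-- The functions Rⁿu share one Lipschitz constant, which survives the pointwise limit. -/
theorem Quadrature.continuous_periodizedSq {K : ℝ} (hN : 2 ≤ N) (hLip : LipschitzBound m₀ K)
    (hm₀ : m₀ 0 = ((√(N : ℝ) : ℝ) : ℂ)) (hq : Quadrature N m₀) :
    Continuous (periodizedSq N m₀) := by
  obtain ⟨δ, hδ, hδπ, hδΦ⟩ := exists_lower_bound_scalingProduct hN hLip hm₀
  have hK := hLip.1
  -- The first entry is the Lipschitz constant of the bump; the second is the threshold above which
  -- R does not increase a Lipschitz constant.
  set L : ℝ := max δ⁻¹ (4 * K * √N)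
  have hL0 : 0 ≤ L := le_max_of_le_left (by positivity)
  have hb : ∀ z, ‖(bump δ * 1 : C(Torus, ℂ)) z‖ ≤ 1 := fun z => by
    rw [mul_one]; exact norm_bump_le hδ z
  have hn : ∀ (n : ℕ) (t s : ℝ), ‖(transferOperator hN m₀ ^ n) (bump δ * 1) (t : Torus) -
      (transferOperator hN m₀ ^ n) (bump δ * 1) (s : Torus)‖ ≤ L * |t - s| := by
    intro n
    induction n with
    | zero =>
      intro t s
      rw [mul_one]
      refine (bump_lipschitz hδ t s).trans ?_
      gcongr
      exact le_max_left _ _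
    | succ n ih =>
      rw [pow_succ']
      exact hq.lipschitz_transfer hN hLip (hq.norm_pow_le hN hb n) (le_max_right _ _) ih
  have hp : ∀ t s : ℝ, |periodizedSq N m₀ (t : Torus) - periodizedSq N m₀ (s : Torus)| ≤
      L * |t - s| := by
    intro t s
    have h1 := ((hq.tendsto_pow_bump_mul hN hLip hm₀ hδ hδπ hδΦ 1 t).sub
      (hq.tendsto_pow_bump_mul hN hLip hm₀ hδ hδπ hδΦ 1 s)).norm
    have h2 := le_of_tendsto h1 (Eventually.of_forall fun n => hn n t s)
    rw [ContinuousMap.one_apply, mul_one, mul_one, ← Complex.ofReal_sub, Complex.norm_real] at h2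
    exact h2
  have hq' : IsQuotientMap ((↑) : ℝ → Torus) := QuotientAddGroup.isQuotientMap_mk _
  rw [hq'.continuous_iff]
  have hl : LipschitzWith L.toNNReal (periodizedSq N m₀ ∘ ((↑) : ℝ → Torus)) :=
    LipschitzWith.of_dist_le_mul fun t s => by
      rw [Real.dist_eq, Real.dist_eq, Real.coe_toNNReal _ hL0]
      exact hp t s
  exact hl.continuous

theorem Quadrature.hasPER {K : ℝ} (hN : 2 ≤ N) (hLip : LipschitzBound m₀ K)
    (hm₀ : m₀ 0 = ((√(N : ℝ) : ℝ) : ℂ)) (hq : Quadrature N m₀) :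
    HasPER (fun t => ((‖scalingProduct N m₀ t‖ ^ 2 : ℝ) : ℂ))
      (fun z => (((2 * π)⁻¹ * periodizedSq N m₀ z : ℝ) : ℂ)) := by
  intro t
  beta_reduce
  rw [periodizedSq_coe, inv_mul_cancel_left₀ Real.two_pi_pos.ne', PER]
  exact Complex.hasSum_ofReal.2 (hq.summable hN hLip hm₀ t).hasSum

theorem HasPER.unique {g : ℝ → ℂ} {G H : Torus → ℂ} (hG : HasPER g G) (hH : HasPER g H) :
    G = H := by
  ext z
  induction z using QuotientAddGroup.induction_on with
  | H t => exact (hG t).unique (hH t)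

/-- The function |Φ|² is fixed by `refinement`, so both sides periodize the same function. -/
theorem Quadrature.transfer_periodizedSq {K : ℝ} (hN : 2 ≤ N) (hLip : LipschitzBound m₀ K)
    (hm₀ : m₀ 0 = ((√(N : ℝ) : ℝ) : ℂ)) (hq : Quadrature N m₀) :
    transfer N m₀ (fun z => (((2 * π)⁻¹ * periodizedSq N m₀ z : ℝ) : ℂ)) =
      fun z => (((2 * π)⁻¹ * periodizedSq N m₀ z : ℝ) : ℂ) := by
  have h := (hq.hasPER hN hLip hm₀).transfer_refinement (m₀ := m₀) hN
  rw [refinement_scalingProduct hN hLip hm₀] at h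
  exact h.unique (hq.hasPER hN hLip hm₀)

theorem one_le_periodizedSq_zero {K : ℝ} (hN : 2 ≤ N) (hLip : LipschitzBound m₀ K)
    (hm₀ : m₀ 0 = ((√(N : ℝ) : ℝ) : ℂ)) (hq : Quadrature N m₀) :
    1 ≤ periodizedSq N m₀ 0 := by
  have h1 := (hq.summable hN hLip hm₀ 0).le_tsum (0 : ℤ) (fun _ _ => by positivity)
  rw [Int.cast_zero, mul_zero, add_zero, scalingProduct_zero hN hLip hm₀,
    norm_two_pi_rpow_sq] at h1
  have h2 := mul_le_mul_of_nonneg_left h1 Real.two_pi_pos.le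
  rw [mul_inv_cancel₀ Real.two_pi_pos.ne'] at h2
  exact h2

theorem periodizedSq_eq_one_iff (t : ℝ) : periodizedSq N m₀ (t : Torus) = 1 ↔
    PER (fun s => ‖scalingProduct N m₀ s‖ ^ 2) t = (2 * π)⁻¹ := by
  rw [periodizedSq_coe, mul_comm, ← eq_div_iff Real.two_pi_pos.ne', one_div]

theorem forall_per_iff : (∀ t : ℝ, PER (fun s => ‖scalingProduct N m₀ s‖ ^ 2) t = (2 * π)⁻¹) ↔
    ∀ z, periodizedSq N m₀ z = 1 := by
  simp_rw [← periodizedSq_eq_one_iff]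
  refine ⟨fun h z => ?_, fun h t => h t⟩
  induction z using QuotientAddGroup.induction_on with
  | H t => exact h t

/-- The quadrature condition follows from the periodization identity almost everywhere. -/
theorem quadrature_of_ae_per {K : ℝ} (hN : 2 ≤ N) (hLip : LipschitzBound m₀ K)
    (hm₀ : m₀ 0 = ((√(N : ℝ) : ℝ) : ℂ))
    (h : ∀ᵐ t : ℝ, PER (fun s => ‖scalingProduct N m₀ s‖ ^ 2) t = (2 * π)⁻¹) :
    Quadrature N m₀ := by
  have hN0 : (N : ℝ) ≠ 0 := by positivity
  have hc : (((2 * π)⁻¹ : ℝ) : ℂ) ≠ 0 := by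
    exact_mod_cast (inv_pos.2 Real.two_pi_pos).ne'
  have h1 : ∀ᵐ t : ℝ, HasSum (fun k : ℤ => ((‖scalingProduct N m₀ (t + 2 * π * k)‖ ^ 2 : ℝ) : ℂ))
      (((2 * π)⁻¹ : ℝ) : ℂ) := by
    filter_upwards [h] with t ht
    refine Complex.hasSum_ofReal.2 ?_
    -- A divergent series would have the default sum 0, which is not 1/(2π).
    have hs : Summable fun k : ℤ => ‖scalingProduct N m₀ (t + 2 * π * k)‖ ^ 2 := by
      by_contra hns
      rw [PER, tsum_eq_zero_of_not_summable hns] at ht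
      exact (inv_pos.2 Real.two_pi_pos).ne ht
    rw [← ht, PER]
    exact hs.hasSum
  -- The identity is needed at all roots of t simultaneously; affine maps preserve null sets.
  have h2 : ∀ᵐ t : ℝ, ∀ j : ℕ,
      HasSum (fun k : ℤ => ((‖scalingProduct N m₀ ((t + 2 * π * j) / N + 2 * π * k)‖ ^ 2 : ℝ) : ℂ))
      (((2 * π)⁻¹ : ℝ) : ℂ) := by
    rw [ae_all_iff]
    intro j
    have hq1 : Measure.QuasiMeasurePreserving (fun t : ℝ => (N : ℝ)⁻¹ • t) volume volume :=
      Measure.quasiMeasurePreserving_smul volume (by positivity)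
    have hq2 := (measurePreserving_add_right (volume : Measure ℝ) (2 * π * j)).quasiMeasurePreserving
    filter_upwards [(hq1.comp hq2).ae h1] with t ht
    rw [Function.comp_apply, smul_eq_mul, inv_mul_eq_div] at ht
    exact ht
  refine quadrature_of_ae hN ?_
  filter_upwards [h1, h2] with t ht1 ht2
  refine quadrature_of_transfer_const hN hc ?_
  have h3 := hasSum_refinement (m₀ := m₀) hN
    (χ := fun s => ((‖scalingProduct N m₀ s‖ ^ 2 : ℝ) : ℂ))
    (G := fun _ => (((2 * π)⁻¹ : ℝ) : ℂ)) fun j _ => ht2 j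
  rw [refinement_scalingProduct hN hLip hm₀] at h3
  exact h3.unique ht1

/-- The almost everywhere identity first gives quadrature, hence continuity of the periodization,
and continuity upgrades the identity to every point. -/
theorem forall_per_of_ae_per {K : ℝ} (hN : 2 ≤ N) (hLip : LipschitzBound m₀ K)
    (hm₀ : m₀ 0 = ((√(N : ℝ) : ℝ) : ℂ))
    (h : ∀ᵐ t : ℝ, PER (fun s => ‖scalingProduct N m₀ s‖ ^ 2) t = (2 * π)⁻¹) (t : ℝ) :
    PER (fun s => ‖scalingProduct N m₀ s‖ ^ 2) t = (2 * π)⁻¹ := by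
  have hq := quadrature_of_ae_per hN hLip hm₀ h
  simp_rw [← periodizedSq_eq_one_iff] at h ⊢
  have hc := (hq.continuous_periodizedSq hN hLip hm₀).comp (AddCircle.continuous_mk' (2 * π))
  exact congrFun ((hc.ae_eq_iff_eq volume continuous_const).1 h) t

/-! ### The eigenspace of the transfer operator -/

theorem transferOperator_one_iff (hN : 2 ≤ N) : transferOperator hN m₀ 1 = 1 ↔ Quadrature N m₀ := by
  refine ⟨fun h z => ?_, fun h => ?_⟩
  · have h1 := DFunLike.congr_fun h z
    induction z using QuotientAddGroup.induction_on with
    | H t => exact quadrature_of_transfer_const hN one_ne_zero h1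
  · ext z
    exact transfer_const hN h 1 z

/-- If `PER(|Φ|²)` is constant, then `Rⁿ f → f(0)` pointwise. -/
theorem Quadrature.tendsto_pow {K : ℝ} (hN : 2 ≤ N) (hLip : LipschitzBound m₀ K)
    (hm₀ : m₀ 0 = ((√(N : ℝ) : ℝ) : ℂ)) (hq : Quadrature N m₀)
    (hp : ∀ z, periodizedSq N m₀ z = 1) (f : C(Torus, ℂ)) (z : Torus) :
    Tendsto (fun n => (transferOperator hN m₀ ^ n) f z) atTop (𝓝 (f 0)) := by
  obtain ⟨δ, hδ, hδπ, hδΦ⟩ := exists_lower_bound_scalingProduct hN hLip hm₀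
  have h1 : ∀ g : C(Torus, ℂ), Tendsto (fun n => (transferOperator hN m₀ ^ n) (bump δ * g) z) atTop
      (𝓝 (g 0)) := fun g => by
    have := hq.tendsto_pow_bump_mul hN hLip hm₀ hδ hδπ hδΦ g z
    rwa [hp, Complex.ofReal_one, one_mul] at this
  have hpow1 : ∀ n : ℕ, (transferOperator hN m₀ ^ n) 1 = 1 := fun n => by
    induction n with
    | zero => rfl
    | succ n ih => rw [pow_succ', Module.End.mul_apply, ih, (transferOperator_one_iff hN).2 hq]
  -- The weights of R are nonnegative, so |Rⁿ((1 - u)f)| ≤ ‖f‖ Rⁿ(1 - u), and Rⁿ(1 - u) = 1 - Rⁿu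
  -- tends to 0.
  have hmono : ∀ (n : ℕ) (z : Torus), ‖(transferOperator hN m₀ ^ n) ((1 - bump δ) * f) z‖ ≤
      ‖f‖ * ((transferOperator hN m₀ ^ n) (1 - bump δ) z).re := by
    intro n
    induction n with
    | zero =>
      intro z
      rw [pow_zero, Module.End.one_apply, Module.End.one_apply, ContinuousMap.mul_apply, norm_mul,
        ContinuousMap.sub_apply, ContinuousMap.one_apply, norm_one_sub_bump hδ, Complex.sub_re,
        Complex.one_re, mul_comm]
      exact mul_le_mul_of_nonneg_right (f.norm_coe_le_norm z)
        (by rw [← norm_one_sub_bump hδ]; exact norm_nonneg _)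
    | succ n ih =>
      intro z
      induction z using QuotientAddGroup.induction_on with
      | H t =>
        rw [pow_succ']
        change ‖transfer N m₀ ((transferOperator hN m₀ ^ n) ((1 - bump δ) * f))
          ((t : ℝ) : Torus)‖ ≤ ‖f‖ * (transfer N m₀ ((transferOperator hN m₀ ^ n) (1 - bump δ))
          ((t : ℝ) : Torus)).re
        rw [transfer_coe hN, transfer_coe hN, Complex.re_sum, Finset.mul_sum]
        refine norm_sum_le_of_le _ fun k _ => ?_
        rw [norm_mul, Complex.norm_real, Real.norm_of_nonneg (by positivity), Complex.re_ofReal_mul,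
          mul_left_comm]
        exact mul_le_mul_of_nonneg_left (ih _) (by positivity)
  have h2 : Tendsto (fun n => ‖f‖ * ((transferOperator hN m₀ ^ n) (1 - bump δ) z).re) atTop
      (𝓝 0) := by
    have h3 := (h1 1).const_sub 1
    rw [ContinuousMap.one_apply, sub_self] at h3
    have h4 := ((Complex.continuous_re.tendsto _).comp h3).const_mul ‖f‖
    rw [Complex.zero_re, mul_zero] at h4
    refine h4.congr fun n => ?_
    rw [Function.comp_apply, map_sub, hpow1, mul_one, ContinuousMap.sub_apply,
      ContinuousMap.one_apply]
  have h5 := (h1 f).add (squeeze_zero_norm (fun n => hmono n z) h2)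
  rw [add_zero] at h5
  refine h5.congr fun n => ?_
  rw [← ContinuousMap.add_apply, ← map_add, ← add_mul, add_sub_cancel, one_mul]

theorem eigenspace_eq_of_per {K : ℝ} (hN : 2 ≤ N) (hLip : LipschitzBound m₀ K)
    (hm₀ : m₀ 0 = ((√(N : ℝ) : ℝ) : ℂ)) (hq : Quadrature N m₀)
    (hp : ∀ z, periodizedSq N m₀ z = 1) :
    Module.End.eigenspace (transferOperator hN m₀) 1 =
      Submodule.span ℂ {(1 : C(Torus, ℂ))} := by
  ext ξ
  rw [Module.End.mem_eigenspace_iff, one_smul, Submodule.mem_span_singleton]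
  constructor
  · intro h
    have hpow : ∀ n : ℕ, (transferOperator hN m₀ ^ n) ξ = ξ := fun n => by
      induction n with
      | zero => rfl
      | succ n ih => rw [pow_succ', Module.End.mul_apply, ih, h]
    refine ⟨ξ 0, ?_⟩
    ext z
    have h1 := hq.tendsto_pow hN hLip hm₀ hp ξ z
    simp only [hpow] at h1
    rw [ContinuousMap.smul_apply, ContinuousMap.one_apply, smul_eq_mul, mul_one]
    exact tendsto_nhds_unique h1 tendsto_const_nhds
  · rintro ⟨c, rfl⟩
    rw [map_smul, (transferOperator_one_iff hN).2 hq]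

theorem per_of_eigenspace_eq {K : ℝ} (hN : 2 ≤ N) (hLip : LipschitzBound m₀ K)
    (hm₀ : m₀ 0 = ((√(N : ℝ) : ℝ) : ℂ))
    (h : Module.End.eigenspace (transferOperator hN m₀) 1 =
      Submodule.span ℂ {(1 : C(Torus, ℂ))}) (z : Torus) : periodizedSq N m₀ z = 1 := by
  have hq : Quadrature N m₀ := by
    rw [← transferOperator_one_iff hN]
    have h1 : (1 : C(Torus, ℂ)) ∈ Module.End.eigenspace (transferOperator hN m₀) 1 := by
      rw [h]; exact Submodule.mem_span_singleton_self _
    rwa [Module.End.mem_eigenspace_iff, one_smul] at h1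
  have hc := hq.continuous_periodizedSq hN hLip hm₀
  let ξ : C(Torus, ℂ) := ⟨fun z => (((2 * π)⁻¹ * periodizedSq N m₀ z : ℝ) : ℂ), by fun_prop⟩
  have hξ : ξ ∈ Module.End.eigenspace (transferOperator hN m₀) 1 := by
    rw [Module.End.mem_eigenspace_iff, one_smul]
    ext w
    exact congrFun (hq.transfer_periodizedSq hN hLip hm₀) w
  rw [h, Submodule.mem_span_singleton] at hξ
  obtain ⟨c, hc⟩ := hξ
  have h2 : ξ z = ξ 0 := by rw [← hc]; rfl
  have h3 : (2 * π)⁻¹ * periodizedSq N m₀ z = (2 * π)⁻¹ * periodizedSq N m₀ 0 := by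
    exact Complex.ofReal_injective h2
  rw [mul_left_cancel₀ (inv_pos.2 Real.two_pi_pos).ne' h3]
  exact le_antisymm (hq.periodizedSq_le_one hN hLip hm₀ 0)
    (one_le_periodizedSq_zero hN hLip hm₀ hq)

/-! ### The operator `S₀` -/

local notation "μT" => (AddCircle.haarAddCircle : Measure Torus)

/-- Averaging over the preimages of the power map preserves the integral. -/
theorem integral_preimageSum (hN : 2 ≤ N) (H : C(Torus, ℂ)) :
    ∫ z, (1 / (N : ℂ)) * preimageSum N H z ∂μT = ∫ z, H z ∂μT := by
  have hN0 : (N : ℝ) ≠ 0 := by positivity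
  have hNc : (N : ℂ) ≠ 0 := by exact_mod_cast (by omega : N ≠ 0)
  rw [integral_const_mul, AddCircle.integral_haarAddCircle, AddCircle.integral_haarAddCircle,
    ← AddCircle.intervalIntegral_preimage (2 * π) 0, ← AddCircle.intervalIntegral_preimage (2 * π) 0,
    mul_smul_comm]
  congr 1
  set h : ℝ → ℂ := fun t => H (t : Torus) with hh
  have hc : Continuous h := H.continuous.comp (AddCircle.continuous_mk' (2 * π))
  -- The j-th branch of the root maps one period onto the j-th of N adjacent intervals of length
  -- 2π/N.
  have h1 : ∀ j : ℕ, ∫ t in (0 : ℝ)..(0 + 2 * π), h ((t + 2 * π * j) / N) =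
      (N : ℂ) * ∫ t in (2 * π * j / N)..(2 * π * (j + 1 : ℕ) / N), h t := fun j => by
    rw [intervalIntegral.integral_comp_add_right (fun t => h (t / N)),
      intervalIntegral.integral_comp_div _ hN0, Complex.real_smul]
    push_cast
    ring_nf
  simp_rw [preimageSum_coe hN]
  change 1 / (N : ℂ) * ∫ t in (0 : ℝ)..(0 + 2 * π), ∑ j ∈ Finset.range N,
    h ((t + 2 * π * j) / N) = ∫ t in (0 : ℝ)..(0 + 2 * π), h t
  rw [intervalIntegral.integral_finsetSum fun (j : ℕ) _ =>
    (by fun_prop : Continuous fun t : ℝ => h ((t + 2 * π * j) / N)).intervalIntegrable _ _]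
  simp_rw [h1]
  rw [← Finset.mul_sum, intervalIntegral.sum_integral_adjacent_intervals
    (a := fun j : ℕ => 2 * π * j / N) fun _ _ => hc.intervalIntegrable _ _, one_div,
    inv_mul_cancel_left₀ hNc]
  congr 1
  · simp
  · field_simp
    simp

/-- The factor h(N • w) is constant on the fibre over z, so it leaves the average. -/
theorem transfer_mul_comp (hN : 2 ≤ N) (F h : Torus → ℂ) (z : Torus) :
    transfer N m₀ (fun w => F w * h (N • w)) z = transfer N m₀ F z * h z := by
  have hN0 : (N : ℝ) ≠ 0 := by positivity
  induction z using QuotientAddGroup.induction_on with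
  | H t =>
    change transfer N m₀ _ ((t : ℝ) : Torus) = transfer N m₀ F ((t : ℝ) : Torus) * h (t : Torus)
    rw [transfer_coe hN, transfer_coe hN, Finset.sum_mul]
    refine Finset.sum_congr rfl fun k _ => ?_
    have h1 : N • (((t + 2 * π * k) / N : ℝ) : Torus) = (t : Torus) := by
      rw [← AddCircle.coe_nsmul, nsmul_eq_mul, mul_div_cancel₀ _ hN0]
      exact_mod_cast coe_add_two_pi_mul t k
    rw [h1]
    ring

/-- `S₀` on continuous functions. -/
def continuousS₀ (N : ℕ) (m₀ g : C(Torus, ℂ)) : C(Torus, ℂ) where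
  toFun z := m₀ z * g (N • z)
  continuous_toFun := by fun_prop

/-- The embedding of `C(𝕋)` in `L²(𝕋)`. -/
abbrev toL2 : C(Torus, ℂ) →L[ℂ] L2Torus := ContinuousMap.toLp 2 μT ℂ

theorem S₀_toL2 (hN : 2 ≤ N) (g : C(Torus, ℂ)) : S₀ hN m₀ (toL2 g) = toL2 (continuousS₀ N m₀ g) := by
  refine Lp.ext ((S₀_ae hN m₀ _).trans ?_)
  have h1 := (measurePreserving_power hN).quasiMeasurePreserving.ae
    (ContinuousMap.coeFn_toLp (p := 2) (𝕜 := ℂ) μT g)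
  filter_upwards [h1, ContinuousMap.coeFn_toLp (p := 2) (𝕜 := ℂ) μT (continuousS₀ N m₀ g)]
    with z hz1 hz2
  rw [hz1, hz2]
  rfl

theorem S₀_pow_oneL2 (hN : 2 ≤ N) (n : ℕ) :
    (S₀ hN m₀ ^ n) oneL2 = toL2 ((continuousS₀ N m₀)^[n] 1) := by
  induction n with
  | zero => rfl
  | succ n ih =>
    rw [pow_succ', mul_apply_eq_comp, ih, S₀_toL2, Function.iterate_succ_apply']

theorem inner_mulOp_toL2 (f g : C(Torus, ℂ)) :
    inner ℂ (toL2 g) (mulOp f (toL2 g)) = ∫ z, f z * ((‖g z‖ ^ 2 : ℝ) : ℂ) ∂μT := by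
  rw [L2.inner_def]
  refine integral_congr_ae ?_
  filter_upwards [mulOp_ae f (toL2 g), ContinuousMap.coeFn_toLp (p := 2) (𝕜 := ℂ) μT g]
    with z hz1 hz2
  rw [hz1, hz2, RCLike.inner_apply, mul_assoc, RCLike.mul_conj]
  simp

/-- R is dual to S₀: average the integrand over the fibres of the power map and pull out |g|². -/
theorem integral_continuousS₀ (hN : 2 ≤ N) (f g : C(Torus, ℂ)) :
    ∫ z, f z * ((‖continuousS₀ N m₀ g z‖ ^ 2 : ℝ) : ℂ) ∂μT =
      ∫ z, transferOperator hN m₀ f z * ((‖g z‖ ^ 2 : ℝ) : ℂ) ∂μT := by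
  let H : C(Torus, ℂ) :=
    ⟨fun z => ((‖m₀ z‖ ^ 2 : ℝ) : ℂ) * (f z * ((‖g (N • z)‖ ^ 2 : ℝ) : ℂ)), by fun_prop⟩
  have h1 : ∀ z, f z * ((‖continuousS₀ N m₀ g z‖ ^ 2 : ℝ) : ℂ) = H z := fun z => by
    change f z * ((‖m₀ z * g (N • z)‖ ^ 2 : ℝ) : ℂ) =
      ((‖m₀ z‖ ^ 2 : ℝ) : ℂ) * (f z * ((‖g (N • z)‖ ^ 2 : ℝ) : ℂ))
    rw [norm_mul, mul_pow]
    push_cast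
    ring
  simp_rw [h1]
  rw [← integral_preimageSum hN H]
  refine integral_congr_ae (Eventually.of_forall fun z => ?_)
  exact transfer_mul_comp (m₀ := m₀) hN f (fun z => ((‖g z‖ ^ 2 : ℝ) : ℂ)) z

theorem integral_iterate_continuousS₀ (hN : 2 ≤ N) (f : C(Torus, ℂ)) (n : ℕ) :
    ∫ z, f z * ((‖(continuousS₀ N m₀)^[n] 1 z‖ ^ 2 : ℝ) : ℂ) ∂μT =
      ∫ z, (transferOperator hN m₀ ^ n) f z ∂μT := by
  induction n generalizing f with
  | zero => simp
  | succ n ih =>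
    rw [Function.iterate_succ_apply', integral_continuousS₀ hN, ih, pow_succ,
      Module.End.mul_apply]

theorem inner_adjoint_pow (hN : 2 ≤ N) (f : C(Torus, ℂ)) (n : ℕ) :
    inner ℂ oneL2 ((ContinuousLinearMap.adjoint (S₀ hN m₀) ^ n * mulOp f * S₀ hN m₀ ^ n) oneL2) =
      ∫ z, (transferOperator hN m₀ ^ n) f z ∂μT := by
  rw [← ContinuousLinearMap.star_eq_adjoint, ← star_pow, ContinuousLinearMap.star_eq_adjoint,
    mul_apply_eq_comp, mul_apply_eq_comp,
    ContinuousLinearMap.adjoint_inner_right, S₀_pow_oneL2, inner_mulOp_toL2,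
    integral_iterate_continuousS₀ hN]

/-- On continuous functions this is the duality with f = 1 and R1 = 1; density gives the rest. -/
theorem Quadrature.norm_S₀ (hN : 2 ≤ N) (hq : Quadrature N m₀) (g : L2Torus) :
    ‖S₀ hN m₀ g‖ = ‖g‖ := by
  have hn : ∀ g : C(Torus, ℂ), ((‖toL2 g‖ ^ 2 : ℝ) : ℂ) =
      ∫ z, (1 : C(Torus, ℂ)) z * ((‖g z‖ ^ 2 : ℝ) : ℂ) ∂μT := fun g => by
    rw [← inner_mulOp_toL2]
    have h1 : mulOp 1 (toL2 g) = toL2 g := by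
      refine Lp.ext ((mulOp_ae _ _).trans (Eventually.of_forall fun z => ?_))
      simp
    rw [h1, inner_self_eq_norm_sq_to_K]
    push_cast
    rfl
  have hd : DenseRange (toL2 : C(Torus, ℂ) → L2Torus) :=
    ContinuousMap.toLp_denseRange ℂ μT ℂ (by norm_num)
  refine hd.induction_on g (isClosed_eq (by fun_prop) (by fun_prop)) fun g => ?_
  have h2 : ((‖S₀ hN m₀ (toL2 g)‖ ^ 2 : ℝ) : ℂ) = ((‖toL2 g‖ ^ 2 : ℝ) : ℂ) := by
    rw [S₀_toL2, hn, hn, integral_continuousS₀ hN, (transferOperator_one_iff hN).2 hq]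
  have h3 := Complex.ofReal_injective h2
  exact (sq_eq_sq₀ (norm_nonneg _) (norm_nonneg _)).1 h3

theorem Quadrature.diracLimit_of_per {K : ℝ} (hN : 2 ≤ N) (hLip : LipschitzBound m₀ K)
    (hm₀ : m₀ 0 = ((√(N : ℝ) : ℝ) : ℂ)) (hq : Quadrature N m₀)
    (hp : ∀ z, periodizedSq N m₀ z = 1) : DiracLimit hN m₀ := by
  intro f
  simp_rw [inner_adjoint_pow]
  have h := tendsto_integral_of_dominated_convergence (μ := μT) (fun _ => ‖f‖)
    (fun n => ((transferOperator hN m₀ ^ n) f).continuous.aestronglyMeasurable)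
    (integrable_const _)
    (fun n => Eventually.of_forall (hq.norm_pow_le hN f.norm_coe_le_norm n))
    (Eventually.of_forall (hq.tendsto_pow hN hLip hm₀ hp f))
  simpa using h

/-- Testing on a bump u, the integrals of Rⁿu tend both to ∫ p and to u(0) = 1. Then 1 - p is
continuous and nonnegative with integral 0. -/
theorem Quadrature.per_of_diracLimit {K : ℝ} (hN : 2 ≤ N) (hLip : LipschitzBound m₀ K)
    (hm₀ : m₀ 0 = ((√(N : ℝ) : ℝ) : ℂ)) (hq : Quadrature N m₀)
    (hD : DiracLimit hN m₀) (z : Torus) : periodizedSq N m₀ z = 1 := by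
  obtain ⟨δ, hδ, hδπ, hδΦ⟩ := exists_lower_bound_scalingProduct hN hLip hm₀
  have hb : ∀ z, ‖(bump δ * 1 : C(Torus, ℂ)) z‖ ≤ 1 := fun z => by
    rw [mul_one]; exact norm_bump_le hδ z
  have h := tendsto_integral_of_dominated_convergence (μ := μT) (fun _ => (1 : ℝ))
    (fun n => ((transferOperator hN m₀ ^ n) (bump δ * 1)).continuous.aestronglyMeasurable)
    (integrable_const _)
    (fun n => Eventually.of_forall (hq.norm_pow_le hN hb n))
    (Eventually.of_forall (hq.tendsto_pow_bump_mul hN hLip hm₀ hδ hδπ hδΦ 1))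
  have h1 := hD (bump δ * 1)
  simp_rw [inner_adjoint_pow] at h1
  have h2 := tendsto_nhds_unique h h1
  simp_rw [ContinuousMap.one_apply, mul_one, bump_zero, integral_complex_ofReal] at h2
  have h3 : ∫ z, periodizedSq N m₀ z ∂μT = 1 := by exact_mod_cast h2
  have hc := hq.continuous_periodizedSq hN hLip hm₀
  have hi : Integrable (periodizedSq N m₀) μT :=
    hc.integrable_of_hasCompactSupport (HasCompactSupport.of_compactSpace _)
  have h4 : ∫ z, (1 - periodizedSq N m₀ z) ∂μT = 0 := by
    rw [integral_sub (integrable_const _) hi, h3]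
    simp
  rw [integral_eq_zero_iff_of_nonneg
    (fun z => sub_nonneg.2 (hq.periodizedSq_le_one hN hLip hm₀ z))
    ((integrable_const _).sub hi)] at h4
  have h5 := congrFun (((continuous_const.sub hc).ae_eq_iff_eq μT continuous_zero).1 h4) z
  exact (sub_eq_zero.1 h5).symm

/-! ### Translates and the Fourier transform -/

/-- The character `ξ ↦ e^{-2πikξ}`. -/
def character (k : ℤ) (ξ : ℝ) : ℂ := Complex.exp (((-2 * π * (k * ξ) : ℝ) : ℂ) * Complex.I)

theorem norm_character (k : ℤ) (ξ : ℝ) : ‖character k ξ‖ = 1 := Complex.norm_exp_ofReal_mul_I _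

theorem continuous_character (k : ℤ) : Continuous (character k) := by
  unfold character
  fun_prop

theorem memLp_character (k : ℤ) : MemLp (character k) ∞ (volume : Measure ℝ) :=
  memLp_top_of_bound (continuous_character k).aestronglyMeasurable 1
    (Eventually.of_forall fun ξ => (norm_character k ξ).le)

/-- Multiplication by a character on `L²(ℝ)`. -/
def modulation (k : ℤ) : L2Real →L[ℂ] L2Real :=
  (ContinuousLinearMap.mul ℂ ℂ).holderL (volume : Measure ℝ) ∞ 2 2 (memLp_character k).toLp

theorem modulation_ae (k : ℤ) (g : L2Real) :
    modulation k g =ᵐ[volume] fun ξ => character k ξ * g ξ := by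
  refine ((ContinuousLinearMap.mul ℂ ℂ).coeFn_holder (r := 2) (memLp_character k).toLp g).trans ?_
  filter_upwards [(memLp_character k).coeFn_toLp] with ξ hξ
  rw [hξ]
  rfl

theorem continuous_translate (k : ℤ) : Continuous fun φ : L2Real => translate φ k :=
  (Lp.compMeasurePreservingₗᵢ ℂ (fun x : ℝ => x - (k : ℝ))
    (measurePreserving_sub_right volume (k : ℝ))).continuous

theorem translate_toLp (f : SchwartzMap ℝ ℂ) (k : ℤ) :
    translate (f.toLp 2) k = (f.compSubConstCLM ℂ (k : ℝ)).toLp 2 := by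
  refine Lp.ext ((Lp.coeFn_compMeasurePreserving _ _).trans ?_)
  have h1 := (measurePreserving_sub_right (volume : Measure ℝ)
    (k : ℝ)).quasiMeasurePreserving.ae_eq_comp (f.coeFn_toLp 2 volume)
  filter_upwards [h1, (f.compSubConstCLM ℂ (k : ℝ)).coeFn_toLp 2] with x hx1 hx2
  rw [hx2, SchwartzMap.compSubConstCLM_apply]
  exact hx1

theorem fourier_compSubConst (f : SchwartzMap ℝ ℂ) (k : ℤ) (ξ : ℝ) :
    𝓕 (f.compSubConstCLM ℂ (k : ℝ)) ξ = character k ξ * 𝓕 f ξ := by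
  rw [SchwartzMap.fourier_coe, SchwartzMap.fourier_coe]
  have h := congrFun (Fourier.fourierIntegral_comp_add_right Real.fourierChar volume
    (f : ℝ → ℂ) (-(k : ℝ))) ξ
  rw [Circle.smul_def, smul_eq_mul, Real.fourierChar_apply] at h
  rw [Real.fourier_real_eq, Real.fourier_real_eq]
  rw [Fourier.fourierIntegral_def, Fourier.fourierIntegral_def] at h
  have h1 : character k ξ = Complex.exp (((2 * π * (-k * ξ) : ℝ) : ℂ) * Complex.I) := by
    rw [character]
    push_cast
    ring_nf
  rw [h1]
  exact h

/-- The Fourier transform turns translation into modulation. -/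
theorem fourier_translate (φ : L2Real) (k : ℤ) :
    (𝓕 (translate φ k) : L2Real) = modulation k (𝓕 φ : L2Real) := by
  have hF : Continuous fun φ : L2Real => (𝓕 φ : L2Real) :=
    (Lp.fourierTransformₗᵢ ℝ ℂ).continuous
  refine (SchwartzMap.denseRange_toLpCLM (F := ℂ) (E := ℝ) (μ := volume) (p := 2)
    ENNReal.ofNat_ne_top).induction_on φ (isClosed_eq (hF.comp (continuous_translate k))
      ((modulation k).continuous.comp hF)) fun f => ?_
  rw [SchwartzMap.toLpCLM_apply, translate_toLp, SchwartzMap.toLp_fourier_eq,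
    SchwartzMap.toLp_fourier_eq]
  refine Lp.ext ?_
  filter_upwards [modulation_ae k ((𝓕 f).toLp 2), (𝓕 f).coeFn_toLp 2,
    (𝓕 (f.compSubConstCLM ℂ (k : ℝ))).coeFn_toLp 2] with ξ h1 h2 h3
  rw [h1, h2, h3, fourier_compSubConst]

theorem norm_fourierHat_sq (φ : L2Real) (t : ℝ) :
    ‖fourierHat φ t‖ ^ 2 = (2 * π)⁻¹ * ‖(𝓕 φ : L2Real) (t / (2 * π))‖ ^ 2 := by
  rw [fourierHat, norm_mul, mul_pow, norm_two_pi_rpow_sq]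

/-- Plancherel and the substitution ξ = t/(2π), whose Jacobian cancels the normalization of
`fourierHat`. The frequency is k - l because the inner product conjugates its first argument. -/
theorem inner_translate (φ : L2Real) (k l : ℤ) :
    inner ℂ (translate φ k) (translate φ l) =
      ∫ t : ℝ, fourier (k - l) (t : Torus) * ((‖fourierHat φ t‖ ^ 2 : ℝ) : ℂ) := by
  rw [← Lp.inner_fourier_eq, fourier_translate, fourier_translate, L2.inner_def]
  have h1 : ∫ t : ℝ, fourier (k - l) (t : Torus) * ((‖fourierHat φ t‖ ^ 2 : ℝ) : ℂ) =
      ∫ t : ℝ, (fun ξ : ℝ => (((2 * π)⁻¹ : ℝ) : ℂ) *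
        (character (l - k) ξ * ((‖(𝓕 φ : L2Real) ξ‖ ^ 2 : ℝ) : ℂ))) (t / (2 * π)) := by
    refine integral_congr_ae (Eventually.of_forall fun t => ?_)
    beta_reduce
    rw [norm_fourierHat_sq, fourier_coe_apply, character]
    have hpi : (π : ℂ) ≠ 0 := by exact_mod_cast Real.pi_ne_zero
    have h2 : 2 * (π : ℂ) * Complex.I * ((k - l : ℤ) : ℂ) * (t : ℂ) / ((2 * π : ℝ) : ℂ) =
        ((-2 * π * (((l - k : ℤ) : ℝ) * (t / (2 * π))) : ℝ) : ℂ) * Complex.I := by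
      push_cast
      field_simp
      ring
    rw [h2]
    push_cast
    ring
  rw [h1, Measure.integral_comp_div (fun ξ : ℝ => (((2 * π)⁻¹ : ℝ) : ℂ) *
        (character (l - k) ξ * ((‖(𝓕 φ : L2Real) ξ‖ ^ 2 : ℝ) : ℂ))), integral_const_mul, Complex.real_smul,
    abs_of_pos Real.two_pi_pos, ← mul_assoc, ← Complex.ofReal_mul,
    mul_inv_cancel₀ Real.two_pi_pos.ne', Complex.ofReal_one, one_mul]
  refine integral_congr_ae ?_
  filter_upwards [modulation_ae k (𝓕 φ : L2Real), modulation_ae l (𝓕 φ : L2Real)] with ξ h2 h3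
  rw [h2, h3, RCLike.inner_apply, map_mul, mul_mul_mul_comm, RCLike.mul_conj, character, character,
    character, ← Complex.exp_conj, ← Complex.exp_add]
  congr 2
  · rw [map_mul, Complex.conj_I, Complex.conj_ofReal]
    push_cast
    ring
  · push_cast
    rfl

/-! ### Periodization of measures -/

theorem lintegral_eq_lintegral_periodization {g : ℝ → ℝ≥0∞} (hg : Measurable g) :
    ∫⁻ t, g t = ∫⁻ t in Set.Ioc 0 (0 + 2 * π), ∑' k : ℤ, g (t + 2 * π * k) := by
  have h1 : ∀ k : ℤ, ∫⁻ t in Set.Ioc (0 + k • (2 * π)) (0 + (k + 1) • (2 * π)), g t =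
      ∫⁻ t in Set.Ioc 0 (0 + 2 * π), g (t + 2 * π * k) := fun k => by
    rw [← (measurePreserving_add_right (volume : Measure ℝ) (2 * π * k)).setLIntegral_comp_preimage
      measurableSet_Ioc hg, Set.preimage_add_const_Ioc]
    simp only [zsmul_eq_mul]
    push_cast
    congr 3 <;> ring_nf
  rw [lintegral_tsum fun (k : ℤ) => (by fun_prop : Measurable fun t : ℝ => g (t + 2 * π * (k : ℝ))).aemeasurable]
  simp_rw [← h1]
  rw [← lintegral_iUnion (fun _ => measurableSet_Ioc)
    (Set.pairwise_disjoint_Ioc_add_zsmul (0 : ℝ) (2 * π)), iUnion_Ioc_add_zsmul Real.two_pi_pos,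
    Measure.restrict_univ]

/-- Fibres are infinite, so only null sets can be controlled: the indicator of the preimage is
periodic and vanishes almost everywhere on one period. -/
theorem quasiMeasurePreserving_coe :
    Measure.QuasiMeasurePreserving ((↑) : ℝ → Torus) volume volume := by
  refine ⟨AddCircle.measurable_mk', Measure.AbsolutelyContinuous.mk fun A hA h0 => ?_⟩
  have hA' := AddCircle.measurable_mk' (a := 2 * π) hA
  rw [Measure.map_apply AddCircle.measurable_mk' hA, ← lintegral_indicator_one hA',
    lintegral_eq_lintegral_periodization (measurable_one.indicator hA')]
  rw [← lintegral_indicator_one hA, ← AddCircle.lintegral_preimage (2 * π) 0] at h0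
  have hm : Measurable fun t : ℝ => A.indicator (1 : Torus → ℝ≥0∞) (t : Torus) :=
    (measurable_one.indicator hA).comp AddCircle.measurable_mk'
  rw [lintegral_eq_zero_iff hm] at h0
  have hm' : Measurable fun t : ℝ => ∑' k : ℤ,
      (((↑) : ℝ → Torus) ⁻¹' A).indicator (1 : ℝ → ℝ≥0∞) (t + 2 * π * k) :=
    Measurable.tsum fun k => (measurable_one.indicator hA').comp (by fun_prop)
  rw [lintegral_eq_zero_iff hm']
  filter_upwards [h0] with t ht
  rw [Pi.zero_apply, ENNReal.tsum_eq_zero]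
  intro k
  refine Eq.trans ?_ ht
  change A.indicator (1 : Torus → ℝ≥0∞) ((t + 2 * π * k : ℝ) : Torus) = A.indicator 1 (t : Torus)
  rw [coe_add_two_pi_mul]

/-- The periodization of a nonnegative function, as a function on the circle. -/
def lperiodization (g : ℝ → ℝ≥0∞) : Torus → ℝ≥0∞ :=
  Function.Periodic.lift (f := fun t => ∑' k : ℤ, g (t + 2 * π * k)) (c := 2 * π) fun t => by
    beta_reduce
    rw [← (Equiv.addLeft (1 : ℤ)).tsum_eq (fun k : ℤ => g (t + 2 * π * k))]
    congr 1
    ext k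
    rw [Equiv.coe_addLeft]
    push_cast
    rw [mul_add, mul_one, add_assoc]

theorem lperiodization_coe (g : ℝ → ℝ≥0∞) (t : ℝ) :
    lperiodization g (t : Torus) = ∑' k : ℤ, g (t + 2 * π * k) := rfl

theorem measurable_lperiodization {g : ℝ → ℝ≥0∞} (hg : Measurable g) :
    Measurable (lperiodization g) := by
  have h1 : lperiodization g = (fun t : ℝ => ∑' k : ℤ, g (t + 2 * π * k)) ∘ Subtype.val ∘
      AddCircle.measurableEquivIoc (2 * π) 0 := by
    ext z
    rw [Function.comp_apply, Function.comp_apply, ← lperiodization_coe]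
    congr 1
    exact ((AddCircle.measurableEquivIoc (2 * π) 0).symm_apply_apply z).symm
  rw [h1]
  exact (Measurable.tsum fun k => hg.comp (by fun_prop)).comp
    (measurable_subtype_coe.comp (AddCircle.measurableEquivIoc (2 * π) 0).measurable)

/-- Membership in the preimage of A is unchanged by shifts of 2πk, so the indicator factors out of
the periodization. -/
theorem map_withDensity_coe {g : ℝ → ℝ≥0∞} (hg : Measurable g) :
    Measure.map ((↑) : ℝ → Torus) (volume.withDensity g) =
      (volume : Measure Torus).withDensity (lperiodization g) := by
  ext A hA
  have hA' := AddCircle.measurable_mk' (a := 2 * π) hA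
  rw [Measure.map_apply AddCircle.measurable_mk' hA, withDensity_apply _ hA', withDensity_apply _ hA,
    ← lintegral_indicator hA', ← lintegral_indicator hA,
    lintegral_eq_lintegral_periodization (hg.indicator hA'), ← AddCircle.lintegral_preimage (2 * π) 0]
  refine lintegral_congr fun t => ?_
  by_cases ht : (t : Torus) ∈ A
  · rw [Set.indicator_of_mem ht, lperiodization_coe]
    refine tsum_congr fun k => Set.indicator_of_mem ?_ _
    rwa [Set.mem_preimage, coe_add_two_pi_mul]
  · rw [Set.indicator_of_notMem ht, ENNReal.tsum_eq_zero]
    refine fun k => Set.indicator_of_notMem ?_ _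
    rwa [Set.mem_preimage, coe_add_two_pi_mul]

theorem ae_torus_iff {p : Torus → Prop} (hp : MeasurableSet {z | p z}) :
    (∀ᵐ z, p z) ↔ ∀ᵐ t : ℝ, p (t : Torus) := by
  refine ⟨fun h => quasiMeasurePreserving_coe.ae h, fun h => ?_⟩
  rw [← (AddCircle.measurePreserving_mk (2 * π) 0).map_eq,
    ae_map_iff AddCircle.measurable_mk'.aemeasurable hp]
  exact ae_restrict_of_ae h

/-- Divergence is excluded on both sides: the extended sum would be ∞, and the real sum would take
the default value 0 < c. -/
theorem tsum_ofReal_eq_iff {a : ℤ → ℝ} (ha : ∀ k, 0 ≤ a k) {c : ℝ} (hc : 0 < c) :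
    ∑' k, ENNReal.ofReal (a k) = ENNReal.ofReal c ↔ ∑' k, a k = c := by
  have key : Summable a → (∑' k, ENNReal.ofReal (a k) = ENNReal.ofReal c ↔ ∑' k, a k = c) :=
    fun hs => by
      rw [← ENNReal.ofReal_tsum_of_nonneg ha hs,
        ENNReal.ofReal_eq_ofReal_iff (tsum_nonneg ha) hc.le]
  constructor
  · intro h
    refine (key ?_).1 h
    have h1 := ENNReal.summable_toReal (h ▸ ENNReal.ofReal_ne_top)
    simpa only [ENNReal.toReal_ofReal (ha _)] using h1
  · intro h
    refine (key ?_).2 h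
    by_contra hns
    rw [tsum_eq_zero_of_not_summable hns] at h
    exact hc.ne h

/-! ### Orthonormality of the translates -/

theorem integral_fourier_haar (n : ℤ) :
    ∫ z, fourier n z ∂(AddCircle.haarAddCircle : Measure Torus) = if n = 0 then 1 else 0 := by
  have h := orthonormal_iff_ite.1 (orthonormal_fourier (T := 2 * π)) 0 n
  rw [fourierLp, fourierLp, ContinuousMap.inner_toLp] at h
  simp only [fourier_zero, map_one, mul_one] at h
  rw [h]
  simp only [eq_comm]

/-- Trigonometric polynomials are uniformly dense in C(𝕋), integration against a finite measure is
uniformly continuous, and finite measures are determined by continuous functions. -/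
theorem measure_eq_iff_integral_fourier {μ ν : Measure Torus} [IsFiniteMeasure μ]
    [IsFiniteMeasure ν] :
    μ = ν ↔ ∀ n : ℤ, ∫ z, fourier n z ∂μ = ∫ z, fourier n z ∂ν := by
  refine ⟨fun h n => by rw [h], fun h => ?_⟩
  have hint : ∀ (ρ : Measure Torus) [IsFiniteMeasure ρ] (f : C(Torus, ℂ)), Integrable f ρ :=
    fun ρ _ f => f.continuous.integrable_of_hasCompactSupport (HasCompactSupport.of_compactSpace f)
  have hcont : ∀ (ρ : Measure Torus) [IsFiniteMeasure ρ],
      Continuous fun f : C(Torus, ℂ) => ∫ z, f z ∂ρ := fun ρ _ => by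
    have h1 : (fun f : C(Torus, ℂ) => ∫ z, f z ∂ρ) =
        fun f => ∫ z, (ContinuousMap.toLp 1 ρ ℂ f : Lp ℂ 1 ρ) z ∂ρ := by
      ext f
      exact (integral_congr_ae (ContinuousMap.coeFn_toLp (p := 1) (𝕜 := ℂ) ρ f)).symm
    rw [h1]
    exact continuous_integral.comp (ContinuousMap.toLp 1 ρ ℂ).continuous
  have hall : ∀ f : C(Torus, ℂ), ∫ z, f z ∂μ = ∫ z, f z ∂ν := by
    intro f
    have hf : f ∈ (Submodule.span ℂ (Set.range (@fourier (2 * π)))).topologicalClosure := by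
      rw [span_fourier_closure_eq_top]; trivial
    have hsub : (Submodule.span ℂ (Set.range (@fourier (2 * π))) : Set C(Torus, ℂ)) ⊆
        {f | ∫ z, f z ∂μ = ∫ z, f z ∂ν} := by
      intro g hg
      induction hg using Submodule.span_induction with
      | mem g hg => obtain ⟨n, rfl⟩ := hg; exact h n
      | zero => simp
      | add a b _ _ ha hb =>
        simp only [Set.mem_ofPred_eq, ContinuousMap.add_apply] at ha hb ⊢
        rw [integral_add (hint μ a) (hint μ b), integral_add (hint ν a) (hint ν b), ha, hb]
      | smul c a _ ha =>
        simp only [Set.mem_ofPred_eq, ContinuousMap.smul_apply] at ha ⊢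
        rw [integral_smul, integral_smul, ha]
    exact closure_minimal hsub (isClosed_eq (hcont μ) (hcont ν)) hf
  refine ext_of_forall_integral_eq_of_IsFiniteMeasure fun f => ?_
  have h1 := hall ⟨fun z => ((f z : ℝ) : ℂ), by fun_prop⟩
  simp only [ContinuousMap.coe_mk, integral_complex_ofReal] at h1
  exact_mod_cast h1

theorem measurable_fourierHat (φ : L2Real) : Measurable (fourierHat φ) := by
  unfold fourierHat
  exact ((Lp.stronglyMeasurable _).measurable.comp (by fun_prop)).const_mul _

/-- The density `|φ̂|²`. -/
def fourierDensity (φ : L2Real) (t : ℝ) : ℝ≥0∞ := ENNReal.ofReal (‖fourierHat φ t‖ ^ 2)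

theorem measurable_fourierDensity (φ : L2Real) : Measurable (fourierDensity φ) :=
  ((measurable_fourierHat φ).norm.pow_const 2).ennreal_ofReal

theorem integrable_norm_fourierHat_sq (φ : L2Real) :
    Integrable fun t => ‖fourierHat φ t‖ ^ 2 := by
  simp_rw [norm_fourierHat_sq]
  have h := ((Lp.memLp (𝓕 φ : L2Real)).integrable_norm_pow two_ne_zero)
  exact (h.comp_div Real.two_pi_pos.ne').const_mul _

instance isFiniteMeasure_fourierDensity (φ : L2Real) :
    IsFiniteMeasure (volume.withDensity (fourierDensity φ)) :=
  isFiniteMeasure_withDensity_ofReal (integrable_norm_fourierHat_sq φ).2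

theorem integral_fourier_fourierDensity (φ : L2Real) (k l : ℤ) :
    ∫ z, fourier (k - l) z ∂(Measure.map ((↑) : ℝ → Torus)
      (volume.withDensity (fourierDensity φ))) = inner ℂ (translate φ k) (translate φ l) := by
  rw [integral_map AddCircle.measurable_mk'.aemeasurable
    (fourier (k - l)).continuous.aestronglyMeasurable,
    integral_withDensity_eq_integral_toReal_smul (measurable_fourierDensity φ)
      (Eventually.of_forall fun _ => ENNReal.ofReal_lt_top), inner_translate]
  refine integral_congr_ae (Eventually.of_forall fun t => ?_)
  beta_reduce
  rw [fourierDensity, ENNReal.toReal_ofReal (by positivity), Complex.real_smul, mul_comm]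

/-- The Gram matrix is Toeplitz, with entries the Fourier coefficients of the wrapped measure; those
of Haar measure are the Kronecker delta. -/
theorem orthonormal_iff_measure_eq (φ : L2Real) :
    Orthonormal ℂ (fun k : ℤ => translate φ k) ↔
      Measure.map ((↑) : ℝ → Torus) (volume.withDensity (fourierDensity φ)) =
        AddCircle.haarAddCircle := by
  rw [measure_eq_iff_integral_fourier, orthonormal_iff_ite]
  simp_rw [← integral_fourier_fourierDensity, integral_fourier_haar]
  refine ⟨fun h n => ?_, fun h k l => ?_⟩
  · simpa using h n 0
  · rw [h]
    simp only [sub_eq_zero]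

/-- The translates of `φ` are orthonormal iff the periodization of `|φ̂|²` is constant. -/
theorem orthonormal_iff_per (φ : L2Real) :
    Orthonormal ℂ (fun k : ℤ => translate φ k) ↔
      ∀ᵐ t : ℝ, PER (fun s => ‖fourierHat φ s‖ ^ 2) t = (2 * π)⁻¹ := by
  have h0 : ENNReal.ofReal (2 * π) ≠ 0 := by
    simpa using Real.pi_pos
  have hhaar : (AddCircle.haarAddCircle : Measure Torus) =
      (volume : Measure Torus).withDensity fun _ => ENNReal.ofReal (2 * π)⁻¹ := by
    rw [withDensity_const, AddCircle.volume_eq_smul_haarAddCircle, smul_smul,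
      ENNReal.ofReal_inv_of_pos Real.two_pi_pos, ENNReal.inv_mul_cancel h0 ENNReal.ofReal_ne_top,
      one_smul]
  have hm := measurable_lperiodization (measurable_fourierDensity φ)
  rw [orthonormal_iff_measure_eq, map_withDensity_coe (measurable_fourierDensity φ), hhaar,
    withDensity_eq_iff_of_sigmaFinite hm.aemeasurable aemeasurable_const]
  refine (ae_torus_iff (hm (measurableSet_singleton _))).trans (eventually_congr
    (Eventually.of_forall fun t => ?_))
  exact tsum_ofReal_eq_iff (fun _ => by positivity) (inv_pos.2 Real.two_pi_pos)

theorem per_congr_ae {ψ χ : ℝ → ℂ} (h : ψ =ᵐ[volume] χ) :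
    ∀ᵐ t : ℝ, PER (fun s => ‖ψ s‖ ^ 2) t = PER (fun s => ‖χ s‖ ^ 2) t := by
  have h1 : ∀ᵐ t : ℝ, ∀ k : ℤ, ψ (t + 2 * π * k) = χ (t + 2 * π * k) := by
    rw [ae_all_iff]
    exact fun k =>
      (measurePreserving_add_right (volume : Measure ℝ) (2 * π * k)).quasiMeasurePreserving.ae h
  filter_upwards [h1] with t ht
  simp only [PER, ht]

theorem ae_per_iff {ψ χ : ℝ → ℂ} (h : ψ =ᵐ[volume] χ) (c : ℝ) :
    (∀ᵐ t : ℝ, PER (fun s => ‖ψ s‖ ^ 2) t = c) ↔ ∀ᵐ t : ℝ, PER (fun s => ‖χ s‖ ^ 2) t = c := by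
  refine eventually_congr ?_
  filter_upwards [per_congr_ae h] with t ht
  rw [ht]

end ScalingFunction

end

/-! ### The equivalences. -/

theorem propositionA1 {N : ℕ} (hN : 2 ≤ N)
    (m₀ : C(ScalingFunction.Torus, ℂ))
    (hLip : ∃ K : ℝ, 0 < K ∧ ∀ t s : ℝ,
      ‖m₀ (t : ScalingFunction.Torus) - m₀ (s : ScalingFunction.Torus)‖ ≤ K * |t - s|)
    (hm₀ : m₀ 0 = ((√(N : ℝ) : ℝ) : ℂ))
    (φ : ScalingFunction.L2Real)
    (φhat : ℝ → ℂ)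
    (hφhat : φhat =ᵐ[volume] ScalingFunction.fourierHat φ)
    (hscale : ∀ᵐ t : ℝ,
      ((√(N : ℝ) : ℝ) : ℂ) * φhat (N * t) = m₀ (t : ScalingFunction.Torus) * φhat t)
    (hcont : ContinuousAt φhat 0)
    (hφhat0 : φhat 0 = (((2 * π) ^ (-(1 / 2) : ℝ) : ℝ) : ℂ)) :
    -- the infinite product converges and represents the Fourier transform of `φ`
    (∀ t : ℝ, Multipliable fun k : ℕ => ScalingFunction.productFactor N m₀ t (k + 1)) ∧
    φhat =ᵐ[volume] ScalingFunction.scalingProduct N m₀ ∧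
    -- the equivalent conditions
    List.TFAE [
      Orthonormal ℂ (fun k : ℤ => ScalingFunction.translate φ k),
      ∀ᵐ t : ℝ, ScalingFunction.PER (fun s => ‖φhat s‖ ^ 2) t = (2 * π)⁻¹,
      ∀ t : ℝ, ScalingFunction.PER (fun s => ‖ScalingFunction.scalingProduct N m₀ s‖ ^ 2) t
        = (2 * π)⁻¹,
      Module.End.eigenspace (ScalingFunction.transferOperator hN m₀) 1
        = Submodule.span ℂ {(1 : C(ScalingFunction.Torus, ℂ))},
      ScalingFunction.QuadratureCondition N m₀ ∧ ScalingFunction.DiracLimit hN m₀] ∧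
    -- given the quadrature condition, `S₀` is an isometry and the limit condition is equivalent
    -- to orthonormality
    (ScalingFunction.QuadratureCondition N m₀ →
      (∀ g : ScalingFunction.L2Torus, ‖ScalingFunction.S₀ hN m₀ g‖ = ‖g‖) ∧
      (Orthonormal ℂ (fun k : ℤ => ScalingFunction.translate φ k) ↔
        ScalingFunction.DiracLimit hN m₀)) := by
  obtain ⟨K, hK⟩ := hLip
  have hLip' : ScalingFunction.LipschitzBound m₀ K := hK
  have hΦ := ScalingFunction.ae_eq_scalingProduct hN hLip' hm₀ hscale hcont hφhat0
  have htfae : List.TFAE [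
      Orthonormal ℂ (fun k : ℤ => ScalingFunction.translate φ k),
      ∀ᵐ t : ℝ, ScalingFunction.PER (fun s => ‖φhat s‖ ^ 2) t = (2 * π)⁻¹,
      ∀ t : ℝ, ScalingFunction.PER (fun s => ‖ScalingFunction.scalingProduct N m₀ s‖ ^ 2) t
        = (2 * π)⁻¹,
      Module.End.eigenspace (ScalingFunction.transferOperator hN m₀) 1
        = Submodule.span ℂ {(1 : C(ScalingFunction.Torus, ℂ))},
      ScalingFunction.QuadratureCondition N m₀ ∧ ScalingFunction.DiracLimit hN m₀] := by
    tfae_have 1 ↔ 2 := by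
      rw [ScalingFunction.orthonormal_iff_per, ScalingFunction.ae_per_iff hφhat]
    tfae_have 2 ↔ 3 := by
      rw [ScalingFunction.ae_per_iff hΦ]
      exact ⟨ScalingFunction.forall_per_of_ae_per hN hLip' hm₀, Eventually.of_forall⟩
    tfae_have 3 → 4 := fun h =>
      ScalingFunction.eigenspace_eq_of_per hN hLip' hm₀
        (ScalingFunction.quadrature_of_ae_per hN hLip' hm₀ (Eventually.of_forall h))
        (ScalingFunction.forall_per_iff.1 h)
    tfae_have 4 → 3 := fun h =>
      ScalingFunction.forall_per_iff.2 (ScalingFunction.per_of_eigenspace_eq hN hLip' hm₀ h)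
    tfae_have 3 → 5 := fun h => by
      have hq := ScalingFunction.quadrature_of_ae_per hN hLip' hm₀ (Eventually.of_forall h)
      exact ⟨(ScalingFunction.quadratureCondition_iff hN).2 hq,
        hq.diracLimit_of_per hN hLip' hm₀ (ScalingFunction.forall_per_iff.1 h)⟩
    tfae_have 5 → 3 := fun h =>
      ScalingFunction.forall_per_iff.2
        (((ScalingFunction.quadratureCondition_iff hN).1 h.1).per_of_diracLimit hN hLip' hm₀ h.2)
    tfae_finish
  refine ⟨ScalingFunction.multipliable_productFactor hN hLip' hm₀, hΦ, htfae, fun hq => ⟨?_, ?_⟩⟩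
  · exact ((ScalingFunction.quadratureCondition_iff hN).1 hq).norm_S₀ hN
  · have h15 : Orthonormal ℂ (fun k : ℤ => ScalingFunction.translate φ k) ↔
        ScalingFunction.QuadratureCondition N m₀ ∧ ScalingFunction.DiracLimit hN m₀ :=
      htfae.out 0 4
    exact h15.trans (and_iff_right hq)
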